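/- For a bounded Lipschitz domain $\Omega\subseteq\mathbb R^2$ (a bounded, connected, nonempty open set that near each boundary point is, in suitable Cartesian coordinates, the region strictly above the graph of a Lipschitz function), let $|\Omega|$ be its area, $|\partial\Omega|$ the one-dimensional Hausdorff measure of its boundary, and $D(\Omega)$ its diameter. Let $0=\mu_1<\mu_2\le\mu_3\le\cdots$ and $0<\lambda_1<\lambda_2\le\cdots$ be the eigenvalues of the Laplacian $-\Delta$ on $\Omega$ with Neumann and with Dirichlet boundary conditions respectively, in the weak sense in $H^1(\Omega)$ and $H^1_0(\Omega)$ and counted with multiplicity, and let $$N(\Omega):=\#\{j\mid \mu_j\le\lambda_1\}.$$ For $j\ge 0$ let $T_j$ be the union of the rectangles $[0,3\cdot 2^{-j}]\times[0,\tfrac12\cdot 2^{-3j}]$ and $[2^{-j},2\cdot 2^{-j}]\times[0,2^{-j}]$, and for $k\ge 1$ let the "rooms and passages" domain $\Omega_k\subseteq\mathbb R^2$ be the interior of $$\bigcup_{j=0}^{k-1}\Big(\big(\textstyle\sum_{i=0}^{j-1}3\cdot 2^{-i},\,0\big)+T_j\Big).$$ **Theorem.** Each $\Omega_k$, $k\ge1$,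 is a bounded Lipschitz domain with $N(\Omega_k)<\infty$. There is a constant $C$ such that for all $k\ge 1$ $$\frac{|\partial\Omega_k|^2}{|\Omega_k|}\le C\quad\text{and}\quad \frac{D(\Omega_k)^2}{|\Omega_k|}\le C,$$ while $N(\Omega_k)\to\infty$ as $k\to\infty$. Consequently there is no constant $C$ such that $N(\Omega)\le C\,\dfrac{|\partial\Omega|^2}{|\Omega|}$ for every bounded Lipschitz domain $\Omega\subseteq\mathbb R^2$; that is, the upper bound conjectured for all bounded Lipschitz domains fails in dimension two. -/

import Mathlib

open MeasureTheory Set Filter Topology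
open scoped ENNReal NNReal ContDiff

/-- The Euclidean plane. -/
abbrev Plane : Type := EuclideanSpace ℝ (Fin 2)

/-! ### Bounded Lipschitz domains -/

/-- A bounded Lipschitz domain in the plane: a bounded, open, connected (in particular nonempty)
set which, near each of its boundary points and in suitable Cartesian coordinates `e`, is the region
strictly above the graph of a Lipschitz function `g`. -/
structure IsBoundedLipschitzDomain (Ω : Set Plane) : Prop where
  isOpen : IsOpen Ω
  isConnected : IsConnected Ω
  isBounded : Bornology.IsBounded Ω
  lipschitz_boundary : ∀ z ∈ frontier Ω, ∃ (e : Plane ≃ₗᵢ[ℝ] Plane) (g : ℝ → ℝ) (K : ℝ≥0) (r : ℝ),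
    LipschitzWith K g ∧ 0 < r ∧ ∀ p ∈ Metric.ball z r, (p ∈ Ω ↔ g (e p 0) < e p 1)

/-! ### Sobolev spaces -/

/-- `φ` is a test function on `Ω`, that is, `φ ∈ C_c^∞(Ω)`. -/
def IsTestFunction (Ω : Set Plane) (φ : Plane → ℝ) : Prop :=
  ContDiff ℝ ∞ φ ∧ HasCompactSupport φ ∧ tsupport φ ⊆ Ω

/-- The Hilbert space `L²(Ω) ⊕ L²(Ω; ℝ²)`, the ambient space for pairs `(u, ∇u)`. Its norm on such
pairs is the norm of `H¹(Ω)`. -/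
abbrev GradientPairs (Ω : Set Plane) : Type :=
  WithLp 2 (Lp ℝ 2 (volume.restrict Ω) × Lp Plane 2 (volume.restrict Ω))

/-- `g` is the weak gradient of `u` on `Ω`: `∫_Ω u ∂_v φ = - ∫_Ω ⟨g, v⟩ φ` for every test function
`φ` on `Ω` and every direction `v`. -/
def IsWeakGradient (Ω : Set Plane) (u : Plane → ℝ) (g : Plane → Plane) : Prop :=
  ∀ φ : Plane → ℝ, IsTestFunction Ω φ → ∀ v : Plane,
    ∫ x in Ω, u x * fderiv ℝ φ x v = - ∫ x in Ω, inner ℝ (g x) v * φ x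

lemma IsTestFunction.memLp {Ω : Set Plane} {φ : Plane → ℝ} (h : IsTestFunction Ω φ) :
    MemLp φ 2 (volume.restrict Ω) :=
  (h.1.continuous.memLp_of_hasCompactSupport h.2.1).restrict Ω

lemma IsTestFunction.fderiv_memLp {Ω : Set Plane} {φ : Plane → ℝ} (h : IsTestFunction Ω φ)
    (v : Plane) : MemLp (fun x => fderiv ℝ φ x v) 2 (volume.restrict Ω) := by
  refine (Continuous.memLp_of_hasCompactSupport ?_ ?_).restrict Ω
  · exact (h.1.continuous_fderiv (by simp)).clm_apply continuous_const
  · exact h.2.1.fderiv_apply ℝ v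

/-- The Sobolev space `H¹(Ω)`, realized as the space of pairs `(u, ∇u)` with `u ∈ L²(Ω)` and weak
gradient `∇u ∈ L²(Ω; ℝ²)`. -/
noncomputable def sobolevH1 (Ω : Set Plane) : Submodule ℝ (GradientPairs Ω) where
  carrier := {w | IsWeakGradient Ω w.fst w.snd}
  zero_mem' := by
    intro φ hφ v
    have h1 : ∀ᵐ x ∂(volume.restrict Ω), (0 : Lp ℝ 2 (volume.restrict Ω)) x = 0 :=
      Lp.coeFn_zero ..
    have h2 : ∀ᵐ x ∂(volume.restrict Ω), (0 : Lp Plane 2 (volume.restrict Ω)) x = 0 :=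
      Lp.coeFn_zero ..
    rw [integral_eq_zero_of_ae, integral_eq_zero_of_ae, neg_zero]
    · filter_upwards [h2] with x hx
      rw [WithLp.zero_snd, hx, inner_zero_left, zero_mul, Pi.zero_apply]
    · filter_upwards [h1] with x hx
      rw [WithLp.zero_fst, hx, zero_mul, Pi.zero_apply]
  add_mem' := by
    intro a b ha hb φ hφ v
    have h1 := Lp.coeFn_add a.fst b.fst
    have h2 := Lp.coeFn_add a.snd b.snd
    have e1 : ∫ x in Ω, (a + b).fst x * fderiv ℝ φ x v =
        ∫ x in Ω, (a.fst x * fderiv ℝ φ x v + b.fst x * fderiv ℝ φ x v) := by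
      refine integral_congr_ae ?_
      filter_upwards [h1] with x hx
      rw [WithLp.add_fst, hx, Pi.add_apply, add_mul]
    have e2 : ∫ x in Ω, inner ℝ ((a + b).snd x) v * φ x =
        ∫ x in Ω, (inner ℝ (a.snd x) v * φ x + inner ℝ (b.snd x) v * φ x) := by
      refine integral_congr_ae ?_
      filter_upwards [h2] with x hx
      rw [WithLp.add_snd, hx, Pi.add_apply, inner_add_left, add_mul]
    rw [e1, e2, integral_add, integral_add, ha φ hφ v, hb φ hφ v, neg_add]
    · exact ((Lp.memLp a.snd).inner_const v).integrable_mul hφ.memLp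
    · exact ((Lp.memLp b.snd).inner_const v).integrable_mul hφ.memLp
    · exact (Lp.memLp a.fst).integrable_mul (hφ.fderiv_memLp v)
    · exact (Lp.memLp b.fst).integrable_mul (hφ.fderiv_memLp v)
  smul_mem' := by
    intro c a ha φ hφ v
    have h1 := Lp.coeFn_smul c a.fst
    have h2 := Lp.coeFn_smul c a.snd
    have e1 : ∫ x in Ω, (c • a).fst x * fderiv ℝ φ x v =
        ∫ x in Ω, c * (a.fst x * fderiv ℝ φ x v) := by
      refine integral_congr_ae ?_
      filter_upwards [h1] with x hx
      rw [WithLp.smul_fst, hx, Pi.smul_apply, smul_eq_mul, mul_assoc]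
    have e2 : ∫ x in Ω, inner ℝ ((c • a).snd x) v * φ x =
        ∫ x in Ω, c * (inner ℝ (a.snd x) v * φ x) := by
      refine integral_congr_ae ?_
      filter_upwards [h2] with x hx
      rw [WithLp.smul_snd, hx, Pi.smul_apply, real_inner_smul_left, mul_assoc]
    rw [e1, e2, integral_const_mul, integral_const_mul, ha φ hφ v, mul_neg]

/-- The Sobolev space `H¹₀(Ω)`: the closure in the `H¹` norm of the space of all pairs `(φ, ∇φ)`
with `φ ∈ C_c^∞(Ω)`. -/
noncomputable def sobolevH10 (Ω : Set Plane) : Submodule ℝ (GradientPairs Ω) :=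
  (Submodule.span ℝ {w : GradientPairs Ω | ∃ φ : Plane → ℝ, IsTestFunction Ω φ ∧
    w.fst =ᵐ[volume.restrict Ω] φ ∧ w.snd =ᵐ[volume.restrict Ω] gradient φ}).topologicalClosure

/-! ### Neumann and Dirichlet eigenvalues of the Laplacian -/

/-- For a space `V` of pairs `(u, ∇u)`, the space of solutions `u ∈ V` of the weak eigenvalue
equation `∫_Ω ⟨∇u, ∇v⟩ = μ ∫_Ω u v` for all `v ∈ V`. With `V = H¹(Ω)` this is the weak form of
`-Δu = μ u` with Neumann boundary condition, with `V = H¹₀(Ω)` that with Dirichlet boundary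
condition. -/
noncomputable def weakEigenspace {Ω : Set Plane} (V : Submodule ℝ (GradientPairs Ω)) (μ : ℝ) :
    Submodule ℝ (GradientPairs Ω) where
  carrier := {w | w ∈ V ∧ ∀ z ∈ V, inner ℝ w.snd z.snd = μ * inner ℝ w.fst z.fst}
  zero_mem' := ⟨V.zero_mem, fun z _ => by simp⟩
  add_mem' := by
    intro a b ha hb
    refine ⟨V.add_mem ha.1 hb.1, fun z hz => ?_⟩
    rw [WithLp.add_fst, WithLp.add_snd, inner_add_left, inner_add_left, ha.2 z hz, hb.2 z hz,
      mul_add]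
  smul_mem' := by
    intro c a ha
    refine ⟨V.smul_mem c ha.1, fun z hz => ?_⟩
    rw [WithLp.smul_fst, WithLp.smul_snd, real_inner_smul_left, real_inner_smul_left, ha.2 z hz]
    ring

/-- The multiplicity of `μ` as a Neumann eigenvalue of `Ω`; it is `0` if `μ` is not a Neumann
eigenvalue. -/
noncomputable def neumannMultiplicity (Ω : Set Plane) (μ : ℝ) : ℕ∞ :=
  Cardinal.toENat (Module.rank ℝ (weakEigenspace (sobolevH1 Ω) μ))

/-- The set of Dirichlet eigenvalues of `Ω`. -/
def dirichletEigenvalues (Ω : Set Plane) : Set ℝ :=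
  {t | weakEigenspace (sobolevH10 Ω) t ≠ ⊥}

/-- The first Dirichlet eigenvalue `λ₁(Ω)`. -/
noncomputable def firstDirichletEigenvalue (Ω : Set Plane) : ℝ :=
  sInf (dirichletEigenvalues Ω)

/-- `N(Ω)`, the number of Neumann eigenvalues of `Ω`, counted with multiplicity, that do not exceed
the first Dirichlet eigenvalue. An eigenvalue `μ` of multiplicity `m` is counted through the `m`
pairs `(μ, 0), …, (μ, m - 1)`. -/
noncomputable def neumannCount (Ω : Set Plane) : ℕ∞ :=
  {q : ℝ × ℕ | q.1 ≤ firstDirichletEigenvalue Ω ∧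
    (q.2 : ℕ∞) < neumannMultiplicity Ω q.1}.encard

/-! ### Perimeter, area, diameter -/

/-- The isoperimetric ratio `|∂Ω|² / |Ω|`, where `|∂Ω|` is the one-dimensional Hausdorff measure of
the boundary and `|Ω|` is the area. -/
noncomputable def isoperimetricRatio (Ω : Set Plane) : ℝ≥0∞ :=
  (Measure.hausdorffMeasure 1 (frontier Ω)) ^ 2 / volume Ω

/-- The ratio `D(Ω)² / |Ω|`, where `D(Ω)` is the diameter. -/
noncomputable def diameterRatio (Ω : Set Plane) : ℝ≥0∞ :=
  (Metric.ediam Ω) ^ 2 / volume Ω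

/-! ### Rooms and passages -/

/-- The closed rectangle `[a, b] × [c, d]`. -/
def rectangle (a b c d : ℝ) : Set Plane :=
  {p | p 0 ∈ Icc a b ∧ p 1 ∈ Icc c d}

/-- The building block `T_j`: the passages `[0, 3·2⁻ʲ] × [0, ½·2⁻³ʲ]` together with the room
`[2⁻ʲ, 2·2⁻ʲ] × [0, 2⁻ʲ]`. -/
def roomBlock (j : ℕ) : Set Plane :=
  rectangle 0 (3 * (1 / 2) ^ j) 0 (1 / 2 * (1 / 2) ^ (3 * j)) ∪
    rectangle ((1 / 2) ^ j) (2 * (1 / 2) ^ j) 0 ((1 / 2) ^ j)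

/-- The abscissa at which the `j`-th block starts, the total width of the preceding blocks. -/
noncomputable def blockOffset (j : ℕ) : ℝ :=
  ∑ i ∈ Finset.range j, 3 * (1 / 2 : ℝ) ^ i

/-- The rooms and passages domain `Ω_k`: the interior of the union of the blocks `T_0, …, T_{k-1}`,
placed next to each other along the horizontal axis. -/
noncomputable def roomsAndPassages (k : ℕ) : Set Plane :=
  interior (⋃ j ∈ Finset.range k, (fun p : Plane => !₂[blockOffset j, 0] + p) '' roomBlock j)

/-! The construction makes each room contribute a Neumann mode of low energy while the perimeter,
diameter and area stay under control. Let `f` be `1` on the `j`-th room and fall linearly to `0`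
along its two passages. Its gradient has size `2^j` on a set of area at most `2 · 2⁻ʲ · ½ · 2⁻³ʲ =
2⁻⁴ʲ`, so its energy is at most `2⁻²ʲ`, the area of the room, which in turn is at most `∫ f²`. The
`k` cut-offs have essentially disjoint supports, so the energy is at most the squared `L²` norm on a
`k`-dimensional subspace of `H¹` (`norm_snd_sq_le_of_mem_span_roomPair`).

All `Ω_k` lie in a strip of width one, hence the first Dirichlet eigenvalue exceeds `1`;
`poincare_strip` gives the sufficient constant `7/5`. By min-max at least `k` Neumann eigenvalues
lie below it. The perimeters are bounded by a geometric series and the area is at least that of the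
unit room, so the isoperimetric ratio stays bounded while the count grows.

Min-max for weak eigenspaces, in the form of counting, is `le_encard_eigenvalues`; finiteness of the
count is `encard_eigenvalues_lt_top`. Both rest on the compactness of `H¹ → L²`, phrased as a
Poincaré inequality with arbitrarily small constant on subspaces of finite codimension. For a finite
union of rectangles it follows from `compactlyEmbedded_sobolevH1`: subdivide the rectangles and
prescribe mean zero on every piece. The chart condition is checked for general finite unions of
rectangles standing on a line (`hasLipschitzChart_iUnion_openBox`). -/

/-! ### Compact symmetric operators on a Hilbert space. -/

section Spectral

variable {E : Type*} [NormedAddCommGroup E] [InnerProductSpace ℝ E] [CompleteSpace E]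

/-- A compact positive self-adjoint operator is bounded by `a` on the orthogonal complement of the
eigenvectors with eigenvalue at least `a`. -/
lemma IsCompactOperator.inner_apply_self_le {J : E →L[ℝ] E} (hJ : IsCompactOperator J)
    (hs : (J : E →ₗ[ℝ] E).IsSymmetric) (hpos : ∀ x, 0 ≤ inner ℝ x (J x)) {a : ℝ} (ha : 0 ≤ a) {u : E}
    (hu : ∀ σ : ℝ, a ≤ σ → ∀ w : E, J w = σ • w → inner ℝ w u = 0) :
    inner ℝ u (J u) ≤ a * ‖u‖ ^ 2 := by
  let K : Submodule ℝ E := (⨆ σ : Ici a, Module.End.eigenspace (J : Module.End ℝ E) σ.1)ᗮ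
  have memK : ∀ x : E, x ∈ K ↔ ∀ σ : ℝ, a ≤ σ → ∀ w : E, J w = σ • w → inner ℝ w x = 0 := by
    intro x
    change x ∈ (⨆ σ : Ici a, Module.End.eigenspace (J : Module.End ℝ E) σ.1)ᗮ ↔ _
    rw [← Submodule.iInf_orthogonal, Submodule.mem_iInf]
    simp [Submodule.mem_orthogonal]
  have hinv : ∀ x ∈ K, (J : E →ₗ[ℝ] E) x ∈ K := by
    intro x hx
    rw [memK] at hx ⊢
    intro σ hσ w hw
    rw [← hs]
    simp [hw, inner_smul_left, hx σ hσ w hw]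
  let S : K →L[ℝ] K := J.restrict hinv
  have hSc : IsCompactOperator S := hJ.restrict' hinv
  have hSs : (S : K →ₗ[ℝ] K).IsSymmetric := hs.restrict_invariant hinv
  have hn : ‖S‖ ≤ a := by
    have h1 : (‖S‖₊ : ℝ≥0∞) ≤ ENNReal.ofReal a := by
      -- For a self-adjoint operator the norm is the spectral radius, and by compactness every
      -- nonzero spectral value is an eigenvalue; the eigenvalues left on `K` are below `a`.
      rw [← S.spectralRadius_eq_nnnorm hSs.isSelfAdjoint, spectralRadius]
      refine iSup₂_le fun σ hσ => ?_
      rcases eq_or_ne σ 0 with rfl | h0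
      · simp
      obtain ⟨w, hw⟩ := ((hSc.hasEigenvalue_iff_mem_spectrum h0).2 hσ).exists_hasEigenvector
      have hw1 : J (w : E) = σ • (w : E) := congrArg Subtype.val hw.apply_eq_smul
      have hw0 : (w : E) ≠ 0 := fun h => hw.2 (by simpa using h)
      have hp : 0 < ‖(w : E)‖ ^ 2 := by positivity
      have hσ0 : 0 ≤ σ := by
        have := hpos w
        rw [hw1, inner_smul_right, real_inner_self_eq_norm_sq] at this
        exact nonneg_of_mul_nonneg_left this hp
      have hσa : σ < a := by
        by_contra! h
        have := (memK w).1 w.2 σ h w hw1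
        rw [real_inner_self_eq_norm_sq] at this
        exact hp.ne' this
      rw [← ENNReal.ofReal_coe_nnreal, coe_nnnorm, Real.norm_of_nonneg hσ0]
      exact ENNReal.ofReal_le_ofReal hσa.le
    rw [← ENNReal.ofReal_coe_nnreal, coe_nnnorm] at h1
    exact (ENNReal.ofReal_le_ofReal_iff ha).1 h1
  have huK : u ∈ K := (memK u).2 hu
  have h2 : J u = S ⟨u, huK⟩ := rfl
  calc inner ℝ u (J u) ≤ ‖u‖ * ‖J u‖ := real_inner_le_norm _ _
    _ = ‖u‖ * ‖S ⟨u, huK⟩‖ := by rw [h2, Submodule.coe_norm]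
    _ ≤ ‖u‖ * (‖S‖ * ‖u‖) := by
      gcongr; exact S.le_opNorm ⟨u, huK⟩
    _ ≤ ‖u‖ * (a * ‖u‖) := by gcongr
    _ = a * ‖u‖ ^ 2 := by ring

/-- An operator that is small on subspaces of finite codimension is compact. -/
lemma isCompactOperator_of_forall_exists_finset {F : Type*} [NormedAddCommGroup F]
    [NormedSpace ℝ F] [CompleteSpace F] (T : E →L[ℝ] F)
    (h : ∀ ε > 0, ∃ S : Finset (E →L[ℝ] ℝ), ∀ u, (∀ L ∈ S, L u = 0) → ‖T u‖ ≤ ε * ‖u‖) :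
    IsCompactOperator T := by
  refine isClosed_setOfPred_isCompactOperator.closure_subset (?_ : T ∈ closure _)
  rw [Metric.mem_closure_iff]
  intro ε hε
  obtain ⟨S, hS⟩ := h (ε / 2) (by positivity)
  let A : E →L[ℝ] (S → ℝ) := ContinuousLinearMap.pi fun L => L.1
  let K : Submodule ℝ E := LinearMap.ker (A : E →ₗ[ℝ] (S → ℝ))
  have hK : IsClosed (K : Set E) := A.isClosed_ker
  have : CompleteSpace K := hK.completeSpace_coe
  have hKm : ∀ u ∈ K, ‖T u‖ ≤ ε / 2 * ‖u‖ := by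
    intro u hu
    refine hS u fun L hL => ?_
    exact congrFun (LinearMap.mem_ker.1 hu) ⟨L, hL⟩
  -- The finitely many functionals cutting out `K` are jointly injective on its orthogonal
  -- complement.
  have : FiniteDimensional ℝ Kᗮ := by
    refine FiniteDimensional.of_injective ((A : E →ₗ[ℝ] (S → ℝ)).comp Kᗮ.subtype) ?_
    rw [← LinearMap.ker_eq_bot, LinearMap.ker_eq_bot']
    intro x hx
    have h1 : (x : E) ∈ K := LinearMap.mem_ker.2 hx
    have h2 := Submodule.inner_right_of_mem_orthogonal h1 x.2
    simpa using h2
  -- The approximant has finite rank; the error is `T` composed with the projection onto `K`, where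
  -- `T` is small.
  refine ⟨T.comp Kᗮ.starProjection, ?_, ?_⟩
  · have hc : IsCompactOperator (T.comp (Kᗮ.subtypeL)) := by
      have hid : IsCompactOperator (id : Kᗮ → Kᗮ) :=
        isCompactOperator_id_iff_finiteDimensional (𝕜 := ℝ).2 inferInstance
      exact hid.clm_comp (T.comp (Kᗮ.subtypeL))
    exact hc.comp_clm Kᗮ.orthogonalProjectionOnto
  · rw [dist_eq_norm]
    refine lt_of_le_of_lt (ContinuousLinearMap.opNorm_le_bound _ (by positivity : 0 ≤ ε / 2) ?_)
      (by linarith)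
    intro x
    have h1 : (T - T.comp Kᗮ.starProjection) x = T (K.starProjection x) := by
      rw [Submodule.starProjection_orthogonal]
      simp
    rw [h1]
    refine (hKm _ (Submodule.starProjection_apply_mem _ _)).trans ?_
    gcongr
    exact K.norm_starProjection_apply_le x

end Spectral

/-! ### Variational characterization and counting of weak eigenvalues. -/

section AbstractEigenvalueProblem

variable {A B : Type*} [NormedAddCommGroup A] [InnerProductSpace ℝ A] [NormedAddCommGroup B]
  [InnerProductSpace ℝ B] {V : Submodule ℝ (WithLp 2 (A × B))}
  {E : ℝ → Submodule ℝ (WithLp 2 (A × B))}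

/-- Variational principle for the abstract eigenvalue problem `⟪u₂, z₂⟫ = μ ⟪u₁, z₁⟫` on a closed
subspace of a product whose first projection is compact. -/
lemma mul_norm_fst_sq_le_of_orthogonal [CompleteSpace A] [CompleteSpace B]
    (hcl : IsClosed (V : Set (WithLp 2 (A × B))))
    (hV : ∀ ε > 0, ∃ S : Finset (WithLp 2 (A × B) →L[ℝ] ℝ), ∀ u ∈ V, (∀ L ∈ S, L u = 0) →
      ‖u.fst‖ ^ 2 ≤ ε * ‖u.snd‖ ^ 2) {c : ℝ} (hc : 0 ≤ c) {u : WithLp 2 (A × B)} (hu : u ∈ V)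
    (hE : ∀ μ w, w ∈ E μ ↔ w ∈ V ∧ ∀ z ∈ V, inner ℝ w.snd z.snd = μ * inner ℝ w.fst z.fst)
    (ho : ∀ μ ≤ c, ∀ w ∈ E μ, inner ℝ w u = 0) :
    c * ‖u.fst‖ ^ 2 ≤ ‖u.snd‖ ^ 2 := by
  have : CompleteSpace V := hcl.completeSpace_coe
  let T : V →L[ℝ] A := (WithLp.fstL 2 ℝ A B).comp V.subtypeL
  have hT : ∀ w : V, T w = (w : WithLp 2 (A × B)).fst := fun _ => rfl
  have hTc : IsCompactOperator T := by
    refine isCompactOperator_of_forall_exists_finset T fun ε hε => ?_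
    classical
    obtain ⟨S, hS⟩ := hV (ε ^ 2) (by positivity)
    refine ⟨S.image fun L => L.comp V.subtypeL, fun w hw => ?_⟩
    have h1 := hS w w.2 fun L hL => hw _ (Finset.mem_image_of_mem _ hL)
    refine abs_le_of_sq_le_sq' ?_ (by positivity) |>.2
    rw [mul_pow, hT, Submodule.coe_norm, WithLp.prod_norm_sq_eq_of_L2 (w : WithLp 2 (A × B))]
    nlinarith [sq_nonneg ‖(w : WithLp 2 (A × B)).fst‖, sq_nonneg ε]
  -- `J` represents the `L²` form in the `H¹` inner product. Since the latter is the `L²` form plus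
  -- the energy, `J w = σ w` is the weak eigenvalue equation with `μ = 1 / σ - 1`, and `σ ≥ 1 / (1 +
  -- c)` corresponds to `μ ≤ c`.
  let J : V →L[ℝ] V := (ContinuousLinearMap.adjoint T).comp T
  have hJi : ∀ x y : V, inner ℝ x (J y) = inner ℝ (T x) (T y) := fun x y =>
    ContinuousLinearMap.adjoint_inner_right T x (T y)
  have hJi' : ∀ x y : V, inner ℝ (J x) y = inner ℝ (T x) (T y) := fun x y =>
    ContinuousLinearMap.adjoint_inner_left T y (T x)
  have key := IsCompactOperator.inner_apply_self_le (J := J)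
    (hTc.clm_comp (ContinuousLinearMap.adjoint T))
    (fun x y => (hJi' x y).trans (hJi x y).symm)
    (fun x => by rw [hJi]; exact real_inner_self_nonneg) (a := 1 / (1 + c)) (by positivity)
    (u := ⟨u, hu⟩) (by
      intro σ hσ w hw
      have hσ0 : 0 < σ := lt_of_lt_of_le (by positivity) hσ
      refine ho (1 / σ - 1) ?_ w ((hE _ _).2 ⟨w.2, fun z hz => ?_⟩)
      · have : 1 / σ ≤ 1 / (1 / (1 + c)) := one_div_le_one_div_of_le (by positivity) hσ
        rw [one_div_one_div] at this
        linarith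
      · have h1 := hJi' w ⟨z, hz⟩
        rw [hw, real_inner_smul_left, Submodule.coe_inner, WithLp.prod_inner_apply, hT, hT] at h1
        change σ * (inner ℝ (w : WithLp 2 (A × B)).fst z.fst +
          inner ℝ (w : WithLp 2 (A × B)).snd z.snd) = inner ℝ (w : WithLp 2 (A × B)).fst z.fst at h1
        field_simp
        linarith)
  rw [hJi, real_inner_self_eq_norm_sq, hT, Submodule.coe_norm] at key
  simp only at key
  rw [WithLp.prod_norm_sq_eq_of_L2, one_div, inv_mul_eq_div, le_div_iff₀ (by positivity)] at key
  linarith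

/-- Test each eigenvalue equation with the other eigenfunction and subtract: by symmetry `(μ - ν)`
times the inner product vanishes. -/
lemma inner_fst_eq_zero_of_mem_eigenspace
    (hE : ∀ μ w, w ∈ E μ ↔ w ∈ V ∧ ∀ z ∈ V, inner ℝ w.snd z.snd = μ * inner ℝ w.fst z.fst)
    {μ ν : ℝ} (h : μ ≠ ν) {u w : WithLp 2 (A × B)}
    (hu : u ∈ E μ) (hw : w ∈ E ν) : inner ℝ u.fst w.fst = 0 := by
  rw [hE] at hu hw
  have h1 := hu.2 w hw.1
  have h2 := hw.2 u hu.1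
  rw [real_inner_comm, real_inner_comm (F := A)] at h2
  have h3 : (μ - ν) * inner ℝ u.fst w.fst = 0 := by linarith
  exact (mul_eq_zero.1 h3).resolve_left (sub_ne_zero.2 h)

/-- On the sum of finitely many weak eigenspaces with eigenvalues at most `c`, the energy is at most
`c` times the squared `L²` norm. -/
lemma norm_snd_sq_le_of_mem_iSup
    (hE : ∀ μ w, w ∈ E μ ↔ w ∈ V ∧ ∀ z ∈ V, inner ℝ w.snd z.snd = μ * inner ℝ w.fst z.fst)
    {F : Finset ℝ} {c : ℝ} (hF : ∀ μ ∈ F, μ ≤ c)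
    {u : WithLp 2 (A × B)} (hu : u ∈ ⨆ μ ∈ F, E μ) :
    ‖u.snd‖ ^ 2 ≤ c * ‖u.fst‖ ^ 2 := by
  obtain ⟨f, rfl⟩ := (Submodule.mem_iSup_finset_iff_exists_sum _ _).1 hu
  have h1 : (∑ μ ∈ F, (f μ : WithLp 2 (A × B))).fst = ∑ μ ∈ F, (f μ : WithLp 2 (A × B)).fst :=
    map_sum (WithLp.fstL 2 ℝ _ _) _ _
  have h2 : (∑ μ ∈ F, (f μ : WithLp 2 (A × B))).snd = ∑ μ ∈ F, (f μ : WithLp 2 (A × B)).snd :=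
    map_sum (WithLp.sndL 2 ℝ _ _) _ _
  -- Different eigenspaces are orthogonal both in `L²` and for the energy, so both quadratic forms
  -- split into sums over the eigenvalues.
  have e1 : ‖(∑ μ ∈ F, (f μ : WithLp 2 (A × B))).fst‖ ^ 2 =
      ∑ μ ∈ F, ‖(f μ : WithLp 2 (A × B)).fst‖ ^ 2 := by
    rw [← real_inner_self_eq_norm_sq, h1, sum_inner]
    refine Finset.sum_congr rfl fun μ hμ => ?_
    rw [inner_sum, Finset.sum_eq_single_of_mem μ hμ, real_inner_self_eq_norm_sq]
    intro ν _ hν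
    exact inner_fst_eq_zero_of_mem_eigenspace hE hν.symm (f μ).2 (f ν).2
  have e2 : ‖(∑ μ ∈ F, (f μ : WithLp 2 (A × B))).snd‖ ^ 2 =
      ∑ μ ∈ F, μ * ‖(f μ : WithLp 2 (A × B)).fst‖ ^ 2 := by
    rw [← real_inner_self_eq_norm_sq, h2, sum_inner]
    refine Finset.sum_congr rfl fun μ hμ => ?_
    rw [inner_sum, Finset.sum_eq_single_of_mem μ hμ, ((hE _ _).1 (f μ).2).2 _ ((hE _ _).1 (f μ).2).1,
      real_inner_self_eq_norm_sq]
    intro ν _ hν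
    rw [((hE _ _).1 (f μ).2).2 _ ((hE _ _).1 (f ν).2).1, inner_fst_eq_zero_of_mem_eigenspace hE hν.symm (f μ).2 (f ν).2,
      mul_zero]
  rw [e1, e2, Finset.mul_sum]
  exact Finset.sum_le_sum fun μ hμ => mul_le_mul_of_nonneg_right (hF μ hμ) (sq_nonneg _)

/-- The index type matches the pairs `(μ, 0), (μ, 1), …` by which eigenvalues are counted. All
infinite ranks become `⊤` and need only a countable independent family. -/
lemma exists_linearIndependent_of_lt_toENat_rank (M : Type*) [AddCommGroup M] [Module ℝ M] :
    ∃ v : {i : ℕ // (i : ℕ∞) < Cardinal.toENat (Module.rank ℝ M)} → M,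
      LinearIndependent ℝ v := by
  let b := Module.Basis.ofVectorSpace ℝ M
  have h : Cardinal.lift (Cardinal.mk {i : ℕ // (i : ℕ∞) < Cardinal.toENat (Module.rank ℝ M)}) ≤
      Cardinal.lift (Cardinal.mk (Module.Basis.ofVectorSpaceIndex ℝ M)) := by
    rw [b.mk_eq_rank'']
    rcases lt_or_ge (Module.rank ℝ M) Cardinal.aleph0 with h | h
    · obtain ⟨n, hn⟩ := Cardinal.lt_aleph0.1 h
      rw [hn, Cardinal.toENat_nat]
      have e : {i : ℕ // (i : ℕ∞) < n} ≃ Fin n :=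
        (Equiv.subtypeEquivRight fun i => by simp).trans Fin.equivSubtype.symm
      rw [Cardinal.mk_congr e]
      simp
    · refine le_trans ?_ (Cardinal.lift_le.2 h)
      simp
  obtain ⟨e⟩ := Cardinal.lift_mk_le'.1 h
  exact ⟨b ∘ e, b.linearIndependent.comp e e.injective⟩

lemma iSupIndep_eigenspace
    (hE : ∀ μ w, w ∈ E μ ↔ w ∈ V ∧ ∀ z ∈ V, inner ℝ w.snd z.snd = μ * inner ℝ w.fst z.fst) :
    iSupIndep E := by
  refine OrthogonalFamily.independent (𝕜 := ℝ) (V := fun μ => E μ) ?_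
  intro μ ν h u w
  have h1 := inner_fst_eq_zero_of_mem_eigenspace hE h u.2 w.2
  have h2 : inner ℝ (u : WithLp 2 (A × B)).snd (w : WithLp 2 (A × B)).snd = 0 := by
    rw [((hE _ _).1 u.2).2 _ ((hE _ _).1 w.2).1, h1, mul_zero]
  change inner ℝ (u : WithLp 2 (A × B)).fst (w : WithLp 2 (A × B)).fst +
    inner ℝ (u : WithLp 2 (A × B)).snd (w : WithLp 2 (A × B)).snd = 0
  rw [h1, h2, add_zero]

/-- A linearly independent family of weak eigenfunctions, indexed by the eigenvalues with
multiplicity. -/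
lemma exists_linearIndependent_eigenvectors
    (hE : ∀ μ w, w ∈ E μ ↔ w ∈ V ∧ ∀ z ∈ V, inner ℝ w.snd z.snd = μ * inner ℝ w.fst z.fst) (c : ℝ) :
    ∃ v : {q : ℝ × ℕ | q.1 ≤ c ∧
      (q.2 : ℕ∞) < Cardinal.toENat (Module.rank ℝ (E q.1))} → WithLp 2 (A × B),
      LinearIndependent ℝ v ∧ ∀ q, v q ∈ E q.1.1 := by
  choose f hf using fun μ : ℝ =>
    exists_linearIndependent_of_lt_toENat_rank (E μ)
  have key := linearIndependent_iUnion_finite (R := ℝ) (f := fun μ i => (f μ i : WithLp 2 (A × B)))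
    (fun μ => (hf μ).map' (E μ).subtype (Submodule.ker_subtype _))
    (by
      intro μ t _ hμ
      have hsub : ∀ ν, Submodule.span ℝ (range fun i => (f ν i : WithLp 2 (A × B))) ≤
          E ν := by
        intro ν
        rw [Submodule.span_le]
        rintro _ ⟨i, rfl⟩
        exact (f ν i).2
      refine (iSupIndep_eigenspace hE μ).mono (hsub μ) (iSup₂_le fun ν hν => ?_)
      exact (hsub ν).trans (le_iSup₂_of_le ν (fun h => hμ (h ▸ hν)) le_rfl))
  refine ⟨fun q => f q.1.1 ⟨q.1.2, q.2.2⟩, ?_, fun q => (f q.1.1 ⟨q.1.2, q.2.2⟩).2⟩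
  refine key.comp (fun q : {q : ℝ × ℕ | q.1 ≤ c ∧
    (q.2 : ℕ∞) < Cardinal.toENat (Module.rank ℝ (E q.1))} => ⟨q.1.1, ⟨q.1.2, q.2.2⟩⟩) ?_
  rintro ⟨⟨μ, i⟩, h⟩ ⟨⟨ν, j⟩, h'⟩ heq
  simp only [Sigma.mk.injEq] at heq
  obtain ⟨rfl, h2⟩ := heq
  simpa using h2

/-- More independent eigenfunctions than functionals in `S` would leave a nonzero combination
annihilated by `S`; on it the smallness inequality contradicts the energy bound by `c`. -/
lemma encard_eigenvalues_lt_top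
    (hV : ∀ ε > 0, ∃ S : Finset (WithLp 2 (A × B) →L[ℝ] ℝ), ∀ u ∈ V, (∀ L ∈ S, L u = 0) →
      ‖u.fst‖ ^ 2 ≤ ε * ‖u.snd‖ ^ 2)
    (hE : ∀ μ w, w ∈ E μ ↔ w ∈ V ∧ ∀ z ∈ V, inner ℝ w.snd z.snd = μ * inner ℝ w.fst z.fst) (c : ℝ) :
    {q : ℝ × ℕ | q.1 ≤ c ∧ (q.2 : ℕ∞) < Cardinal.toENat (Module.rank ℝ (E q.1))}.encard < ⊤ := by
  classical
  -- With this constant, `(|c| + 1) ‖u.fst‖² ≤ ‖u.snd‖² ≤ c ‖u.fst‖²` forces `u = 0`.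
  obtain ⟨S, hS⟩ := hV (1 / (|c| + 1)) (by positivity)
  obtain ⟨v, hv, hvE⟩ := exists_linearIndependent_eigenvectors hE c
  rw [lt_top_iff_ne_top]
  intro htop
  have hinf := Set.encard_eq_top_iff.1 htop
  have : Infinite _ := hinf.to_subtype
  obtain ⟨t, ht⟩ := Infinite.exists_subset_card_eq {q : ℝ × ℕ | q.1 ≤ c ∧
    (q.2 : ℕ∞) < Cardinal.toENat (Module.rank ℝ (E q.1))} (S.card + 1)
  let A : (t → ℝ) →ₗ[ℝ] (S → ℝ) :=
    LinearMap.pi fun L => (L.1 : WithLp 2 (A × B) →ₗ[ℝ] ℝ).comp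
      (Fintype.linearCombination ℝ fun q : t => v q)
  obtain ⟨x, hx, hx0⟩ := (Submodule.ne_bot_iff _).1
    (LinearMap.ker_ne_bot_of_finrank_lt (f := A) (by simp [ht]))
  set u := Fintype.linearCombination ℝ (fun q : t => v q) x with hu
  have hu0 : u ≠ 0 := by
    intro h
    refine hx0 (funext fun i => ?_)
    refine Fintype.linearIndependent_iff.1 (hv.comp (Subtype.val : t → _)
      Subtype.val_injective) x ?_ i
    rw [← h, hu, Fintype.linearCombination_apply]
    rfl
  have huF : u ∈ ⨆ μ ∈ t.image (fun q => q.1.1), E μ := by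
    rw [hu, Fintype.linearCombination_apply]
    refine Submodule.sum_mem _ fun q _ => Submodule.smul_mem _ _ ?_
    exact Submodule.mem_iSup_of_mem q.1.1.1
      (Submodule.mem_iSup_of_mem (Finset.mem_image_of_mem _ q.2) (hvE q))
  have huV : u ∈ V := (iSup₂_le fun μ _ w hw => ((hE _ _).1 hw).1 : _ ≤ V) huF
  have h1 := norm_snd_sq_le_of_mem_iSup hE (c := c) (by
    intro μ hμ
    obtain ⟨q, _, rfl⟩ := Finset.mem_image.1 hμ
    exact q.2.1) huF
  have h2 := hS u huV fun L hL => congrFun (LinearMap.mem_ker.1 hx) ⟨L, hL⟩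
  rw [one_div, inv_mul_eq_div, le_div_iff₀ (by positivity)] at h2
  have h3 : ‖u.fst‖ ^ 2 ≤ 0 := by nlinarith [le_abs_self c, sq_nonneg ‖u.fst‖]
  have h4 : ‖u.snd‖ ^ 2 ≤ 0 := by
    have : ‖u.fst‖ ^ 2 = 0 := le_antisymm h3 (sq_nonneg _)
    rwa [this, mul_zero] at h1
  have h5 : ‖u‖ ^ 2 ≤ 0 := by
    rw [WithLp.prod_norm_sq_eq_of_L2]
    linarith
  exact hu0 (norm_eq_zero.1 (pow_eq_zero_iff two_ne_zero |>.1 (le_antisymm h5 (sq_nonneg _))))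

/-- Min-max by dimension count: with fewer than `n` eigenvalues up to `c`, some nonzero `u` in the
`n`-dimensional span is orthogonal to all their eigenfunctions, and then
`mul_norm_fst_sq_le_of_orthogonal` contradicts the strict energy bound. -/
lemma le_encard_eigenvalues [CompleteSpace A] [CompleteSpace B]
    (hcl : IsClosed (V : Set (WithLp 2 (A × B))))
    (hV : ∀ ε > 0, ∃ S : Finset (WithLp 2 (A × B) →L[ℝ] ℝ), ∀ u ∈ V, (∀ L ∈ S, L u = 0) →
      ‖u.fst‖ ^ 2 ≤ ε * ‖u.snd‖ ^ 2)
    (hE : ∀ μ w, w ∈ E μ ↔ w ∈ V ∧ ∀ z ∈ V, inner ℝ w.snd z.snd = μ * inner ℝ w.fst z.fst)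
    {c : ℝ} (hc : 0 ≤ c) {n : ℕ}
    {v : Fin n → WithLp 2 (A × B)} (hv : LinearIndependent ℝ v) (hvV : ∀ i, v i ∈ V)
    (hlt : ∀ u ∈ Submodule.span ℝ (range v), u ≠ 0 → ‖u.snd‖ ^ 2 < c * ‖u.fst‖ ^ 2) :
    (n : ℕ∞) ≤
      {q : ℝ × ℕ | q.1 ≤ c ∧ (q.2 : ℕ∞) < Cardinal.toENat (Module.rank ℝ (E q.1))}.encard := by
  set S := {q : ℝ × ℕ | q.1 ≤ c ∧
    (q.2 : ℕ∞) < Cardinal.toENat (Module.rank ℝ (E q.1))} with hS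
  by_contra! hlt'
  have hfin : S.Finite := Set.finite_of_encard_le_coe hlt'.le
  -- The spanning vectors of each eigenspace are indexed by the pairs in `S`. The eigenspace has
  -- finite dimension, since otherwise `S` would contain `(μ, i)` for all `i`; beyond the dimension
  -- `w` has the junk value `0`.
  have hw : ∀ μ : ℝ, ∃ w : ℕ → WithLp 2 (A × B), μ ≤ c →
      E μ ≤ Submodule.span ℝ (w '' {i | (μ, i) ∈ S}) := by
    intro μ
    by_cases hμ : μ ≤ c
    swap
    · exact ⟨0, fun h => absurd h hμ⟩
    have hr : Module.rank ℝ (E μ) < Cardinal.aleph0 := by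
      by_contra! h
      rw [← Cardinal.toENat_eq_top] at h
      refine (hfin.preimage (f := fun i : ℕ => (μ, i)) (by intro a _ b _ h; simpa using h)).not_infinite ?_
      convert Set.infinite_univ (α := ℕ)
      ext i
      have h2 : (i : ℕ∞) < ⊤ := ENat.natCast_lt_top i
      rw [← h] at h2
      exact ⟨fun _ => mem_univ _, fun _ => ⟨hμ, h2⟩⟩
    have : FiniteDimensional ℝ (E μ) := Module.rank_lt_aleph0_iff.1 hr
    let b := Module.finBasis ℝ (E μ)
    refine ⟨fun i => if h : i < Module.finrank ℝ (E μ) then b ⟨i, h⟩ else 0,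
      fun _ x hx => ?_⟩
    have h1 := b.sum_repr ⟨x, hx⟩
    have h2 : x = ∑ i, b.repr ⟨x, hx⟩ i • (b i : WithLp 2 (A × B)) := by
      have h3 := congrArg (E μ).subtype h1
      rw [map_sum] at h3
      simpa only [map_smul, Submodule.subtype_apply] using h3.symm
    rw [h2]
    refine Submodule.sum_mem _ fun i _ => Submodule.smul_mem _ _ (Submodule.subset_span
      ⟨i, ⟨hμ, ?_⟩, by simp⟩)
    rw [← Module.finrank_eq_rank, Cardinal.toENat_nat]
    exact_mod_cast i.2
  choose w hw using hw
  have : Fintype S := hfin.fintype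
  have hcard : Fintype.card S < n := by
    rw [← Nat.cast_lt (α := ℕ∞)]
    rwa [Set.encard_eq_coe_toFinset_card, Set.toFinset_card] at hlt'
  let A : (Fin n → ℝ) →ₗ[ℝ] (S → ℝ) :=
    LinearMap.pi fun q => (innerₛₗ ℝ (w q.1.1 q.1.2)).comp (Fintype.linearCombination ℝ v)
  obtain ⟨x, hx, hx0⟩ := (Submodule.ne_bot_iff _).1
    (LinearMap.ker_ne_bot_of_finrank_lt (f := A) (by simpa using hcard))
  set u := Fintype.linearCombination ℝ v x with hu
  have hu0 : u ≠ 0 := by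
    intro h
    refine hx0 (funext fun i => ?_)
    exact Fintype.linearIndependent_iff.1 hv x (by rw [← h, hu, Fintype.linearCombination_apply]) i
  have hus : u ∈ Submodule.span ℝ (range v) := by
    rw [← Fintype.range_linearCombination ℝ v]
    exact LinearMap.mem_range_self _ _
  have huV : u ∈ V := Submodule.span_le.2 (by rintro _ ⟨i, rfl⟩; exact hvV i) hus
  refine (hlt u hus hu0).not_ge (mul_norm_fst_sq_le_of_orthogonal hcl hV hc huV hE fun μ hμ z hz => ?_)
  have h3 : Submodule.span ℝ (w μ '' {i | (μ, i) ∈ S}) ≤ (ℝ ∙ u)ᗮ := by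
    rw [Submodule.span_le]
    rintro _ ⟨i, hi, rfl⟩
    rw [SetLike.mem_coe, Submodule.mem_orthogonal_singleton_iff_inner_left]
    exact congrFun (LinearMap.mem_ker.1 hx) ⟨(μ, i), hi⟩
  exact Submodule.mem_orthogonal_singleton_iff_inner_left.1 (h3 (hw μ hμ hz))

end AbstractEigenvalueProblem

/-! ### Sobolev spaces and the Poincaré inequality with Dirichlet condition. -/

section Sobolev

variable {Ω : Set Plane}

/-- On subspaces of `V` of finite codimension, the Dirichlet energy dominates every multiple of the
squared `L²` norm; equivalently `V` embeds compactly into `L²`. -/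
def CompactlyEmbedded (V : Submodule ℝ (GradientPairs Ω)) : Prop :=
  ∀ ε > 0, ∃ S : Finset (GradientPairs Ω →L[ℝ] ℝ), ∀ u ∈ V, (∀ L ∈ S, L u = 0) →
    ‖u.fst‖ ^ 2 ≤ ε * ‖u.snd‖ ^ 2

lemma CompactlyEmbedded.mono {V W : Submodule ℝ (GradientPairs Ω)} (hV : CompactlyEmbedded V)
    (h : W ≤ V) : CompactlyEmbedded W := by
  intro ε hε
  obtain ⟨S, hS⟩ := hV ε hε
  exact ⟨S, fun u hu => hS u (h hu)⟩

lemma norm_sq_eq_integral {F : Type*} [NormedAddCommGroup F] [InnerProductSpace ℝ F]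
    {μ : Measure Plane} {w : Lp F 2 μ} {f : Plane → F} (h : w =ᵐ[μ] f) :
    ‖w‖ ^ 2 = ∫ x, ‖f x‖ ^ 2 ∂μ := by
  rw [← real_inner_self_eq_norm_sq, L2.inner_def]
  refine integral_congr_ae ?_
  filter_upwards [h] with x hx
  rw [hx, real_inner_self_eq_norm_sq]

/-- For a fixed test function and direction, both sides of the weak gradient identity are inner
products with fixed `L²` elements, so `H¹` is an intersection of closed conditions. -/
lemma isClosed_sobolevH1 (Ω : Set Plane) : IsClosed (sobolevH1 Ω : Set (GradientPairs Ω)) := by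
  have : (sobolevH1 Ω : Set (GradientPairs Ω)) =
      ⋂ (φ : Plane → ℝ) (_ : IsTestFunction Ω φ) (v : Plane), {w : GradientPairs Ω |
        ∫ x in Ω, w.fst x * fderiv ℝ φ x v = - ∫ x in Ω, inner ℝ (w.snd x) v * φ x} := by
    ext w
    simp only [mem_iInter]
    rfl
  rw [this]
  refine isClosed_iInter fun φ => isClosed_iInter fun hφ => isClosed_iInter fun v => ?_
  have hm : MemLp (fun x => φ x • v) 2 (volume.restrict Ω) := by
    refine (Continuous.memLp_of_hasCompactSupport ?_ ?_).restrict Ω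
    · exact hφ.1.continuous.smul continuous_const
    · exact hφ.2.1.smul_right
  have e1 : ∀ w : GradientPairs Ω, ∫ x in Ω, w.fst x * fderiv ℝ φ x v =
      inner ℝ ((hφ.fderiv_memLp v).toLp _) w.fst := by
    intro w
    rw [L2.inner_def]
    refine integral_congr_ae ?_
    filter_upwards [(hφ.fderiv_memLp v).coeFn_toLp] with x hx
    rw [hx]
    simp
  have e2 : ∀ w : GradientPairs Ω, ∫ x in Ω, inner ℝ (w.snd x) v * φ x =
      inner ℝ (hm.toLp _) w.snd := by
    intro w
    rw [L2.inner_def]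
    refine integral_congr_ae ?_
    filter_upwards [hm.coeFn_toLp] with x hx
    rw [hx, real_inner_smul_left, real_inner_comm, mul_comm]
  simp_rw [e1, e2]
  have c1 : Continuous fun w : GradientPairs Ω => w.fst := (WithLp.fstL 2 ℝ _ _).continuous
  have c2 : Continuous fun w : GradientPairs Ω => w.snd := (WithLp.sndL 2 ℝ _ _).continuous
  exact isClosed_eq (continuous_const.inner c1) (continuous_const.inner c2).neg

/-- Rademacher's theorem makes the pointwise gradient exist almost everywhere, and Lipschitz
functions can be integrated by parts against test functions. This admits the piecewise linear
cut-offs of the rooms. -/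
lemma LipschitzWith.isWeakGradient_gradient {f : Plane → ℝ} {K : ℝ≥0} (hf : LipschitzWith K f)
    (Ω : Set Plane) : IsWeakGradient Ω f (gradient f) := by
  intro φ hφ v
  have hout : ∀ x ∉ Ω, x ∉ tsupport φ := fun x hx h => hx (hφ.2.2 h)
  rw [setIntegral_eq_integral_of_forall_compl_eq_zero, setIntegral_eq_integral_of_forall_compl_eq_zero]
  · obtain ⟨D, hD⟩ := hφ.1.lipschitzWith_of_hasCompactSupport hφ.2.1 (by simp)
    have key := hf.integral_lineDeriv_mul_eq (μ := volume) hD hφ.2.1 v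
    have e1 : ∫ x, inner ℝ (gradient f x) v * φ x = ∫ x, lineDeriv ℝ f x v * φ x := by
      refine integral_congr_ae ?_
      filter_upwards [hf.ae_differentiableAt (μ := volume)] with x hx
      rw [hx.lineDeriv_eq_fderiv, inner_gradient_left]
    rw [e1, key, ← integral_neg]
    refine integral_congr_ae (Eventually.of_forall fun x => ?_)
    have := (hφ.1.differentiable (by simp) x).lineDeriv_eq_fderiv (v := -v)
    simp only [this, map_neg]
    ring
  · intro x hx
    rw [image_eq_zero_of_notMem_tsupport (hout x hx), mul_zero]
  · intro x hx
    rw [fderiv_of_notMem_tsupport ℝ (hout x hx)]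
    simp

lemma mem_sobolevH1_of_lipschitz {f : Plane → ℝ} {K : ℝ≥0} (hf : LipschitzWith K f)
    {w : GradientPairs Ω} (h1 : w.fst =ᵐ[volume.restrict Ω] f)
    (h2 : w.snd =ᵐ[volume.restrict Ω] gradient f) : w ∈ sobolevH1 Ω := by
  intro φ hφ v
  have := hf.isWeakGradient_gradient Ω φ hφ v
  have e1 : ∫ x in Ω, w.fst x * fderiv ℝ φ x v = ∫ x in Ω, f x * fderiv ℝ φ x v := by
    refine integral_congr_ae ?_
    filter_upwards [h1] with x hx
    rw [hx]
  have e2 : ∫ x in Ω, inner ℝ (w.snd x) v * φ x = ∫ x in Ω, inner ℝ (gradient f x) v * φ x := by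
    refine integral_congr_ae ?_
    filter_upwards [h2] with x hx
    rw [hx]
  rw [e1, this, e2]

lemma isClosed_sobolevH10 (Ω : Set Plane) : IsClosed (sobolevH10 Ω : Set (GradientPairs Ω)) :=
  Submodule.isClosed_topologicalClosure _

lemma sobolevH10_le_sobolevH1 (Ω : Set Plane) : sobolevH10 Ω ≤ sobolevH1 Ω := by
  refine Submodule.topologicalClosure_minimal _ ?_ (isClosed_sobolevH1 Ω)
  rw [Submodule.span_le]
  rintro w ⟨φ, hφ, h1, h2⟩
  obtain ⟨D, hD⟩ := hφ.1.lipschitzWith_of_hasCompactSupport hφ.2.1 (by simp)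
  exact mem_sobolevH1_of_lipschitz hD h1 h2

lemma IsTestFunction.gradient_memLp {φ : Plane → ℝ} (h : IsTestFunction Ω φ) :
    MemLp (gradient φ) 2 (volume.restrict Ω) := by
  refine (Continuous.memLp_of_hasCompactSupport ?_ ?_).restrict Ω
  · exact (InnerProductSpace.toDual ℝ Plane).symm.continuous.comp
      (h.1.continuous_fderiv (by simp))
  · exact (h.2.1.fderiv ℝ).comp_left (map_zero _)

/-- The pair `(φ, ∇φ)` of a test function. -/
noncomputable def IsTestFunction.pair {φ : Plane → ℝ} (h : IsTestFunction Ω φ) :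
    GradientPairs Ω :=
  WithLp.toLp 2 (h.memLp.toLp φ, h.gradient_memLp.toLp (gradient φ))

lemma IsTestFunction.pair_mem {φ : Plane → ℝ} (h : IsTestFunction Ω φ) :
    h.pair ∈ sobolevH10 Ω :=
  Submodule.le_topologicalClosure _ (Submodule.subset_span
    ⟨φ, h, h.memLp.coeFn_toLp, h.gradient_memLp.coeFn_toLp⟩)

lemma gradient_add_of_differentiable {f g : Plane → ℝ} (hf : Differentiable ℝ f)
    (hg : Differentiable ℝ g) : gradient (f + g) = gradient f + gradient g := by
  ext1 x
  simp [gradient, fderiv_add (hf x) (hg x)]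

/-- The spanning set is already a linear subspace. Hence an inequality on `H¹₀` need only be checked
for single test functions before passing to the closure. -/
lemma exists_testFunction_of_mem_span {w : GradientPairs Ω}
    (hw : w ∈ Submodule.span ℝ {w : GradientPairs Ω | ∃ φ : Plane → ℝ, IsTestFunction Ω φ ∧
      w.fst =ᵐ[volume.restrict Ω] φ ∧ w.snd =ᵐ[volume.restrict Ω] gradient φ}) :
    ∃ φ : Plane → ℝ, IsTestFunction Ω φ ∧
      w.fst =ᵐ[volume.restrict Ω] φ ∧ w.snd =ᵐ[volume.restrict Ω] gradient φ := by
  induction hw using Submodule.span_induction with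
  | mem x hx => exact hx
  | zero =>
    refine ⟨0, ⟨contDiff_const, HasCompactSupport.zero, ?_⟩, Lp.coeFn_zero .., ?_⟩
    · rw [tsupport_eq_empty_iff.2 rfl]; exact empty_subset _
    · have : gradient (0 : Plane → ℝ) = 0 := gradient_const' 0
      rw [this]
      exact Lp.coeFn_zero ..
  | add a b _ _ ha hb =>
    obtain ⟨φ, hφ, a1, a2⟩ := ha
    obtain ⟨ψ, hψ, b1, b2⟩ := hb
    refine ⟨φ + ψ, ⟨hφ.1.add hψ.1, hφ.2.1.add hψ.2.1,
      (tsupport_add φ ψ).trans (union_subset hφ.2.2 hψ.2.2)⟩, ?_, ?_⟩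
    · exact (Lp.coeFn_add a.fst b.fst).trans (a1.add b1)
    · rw [gradient_add_of_differentiable (hφ.1.differentiable (by simp))
        (hψ.1.differentiable (by simp))]
      exact (Lp.coeFn_add a.snd b.snd).trans (a2.add b2)
  | smul c a _ ha =>
    obtain ⟨φ, hφ, a1, a2⟩ := ha
    refine ⟨c • φ, ⟨hφ.1.const_smul c, hφ.2.1.smul_left, ?_⟩, ?_, ?_⟩
    · exact (tsupport_smul_subset_right (fun _ => c) φ).trans hφ.2.2
    · exact (Lp.coeFn_smul c a.fst).trans (a1.const_smul c)
    · have : gradient (c • φ) = c • gradient φ := by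
        ext1 x
        simp [gradient, fderiv_const_smul (hφ.1.differentiable (by simp) x)]
      rw [this]
      exact (Lp.coeFn_smul c a.snd).trans (a2.const_smul c)

/-- A Poincaré inequality for smooth functions supported in a strip of unit width. -/
lemma poincare_strip {φ : Plane → ℝ} (hφ : ContDiff ℝ ∞ φ) (hc : HasCompactSupport φ)
    (hs : ∀ x, φ x ≠ 0 → x 1 ∈ Icc (0 : ℝ) 1) :
    7 / 5 * ∫ x, φ x ^ 2 ≤ ∫ x, ‖gradient φ x‖ ^ 2 := by
  let e : Plane := EuclideanSpace.single 1 1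
  let t : Plane → ℝ := fun x => x 1 - 1 / 2
  have hd : Continuous fun x => fderiv ℝ φ x e :=
    (hφ.continuous_fderiv (by simp)).clm_apply continuous_const
  have hdc : HasCompactSupport fun x => fderiv ℝ φ x e := hc.fderiv_apply ℝ e
  have hφc := hφ.continuous
  have ht : Continuous t := by fun_prop
  have hgc : Continuous (gradient φ) :=
    (InnerProductSpace.toDual ℝ Plane).symm.continuous.comp (hφ.continuous_fderiv (by simp))
  have hgs : HasCompactSupport (gradient φ) := (hc.fderiv ℝ).comp_left (map_zero _)
  -- For any weight `W` of `t`, expanding `∫ (∂φ + W φ)² ≥ 0` and integrating by parts gives `∫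
  -- (∂φ)² ≥ ∫ (W' - W²) φ²`. The sharp weight `π tan (π t)` would yield `π²`; a linear weight
  -- yields at most `1` for `|t| ≤ 1/2`, which is not enough, while this cubic gives `W' - W² = 2 -
  -- t² - 4 t⁴ - t⁶ ≥ 7/5`.
  let W : Plane → ℝ := fun x => 2 * t x + t x ^ 3
  have htd : ∀ x, HasFDerivAt t (EuclideanSpace.proj (1 : Fin 2) : Plane →L[ℝ] ℝ) x := fun x =>
    ((EuclideanSpace.proj (1 : Fin 2) : Plane →L[ℝ] ℝ).hasFDerivAt).sub_const _
  have hφd : ∀ x, HasFDerivAt φ (fderiv ℝ φ x) x := fun x =>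
    (hφ.differentiable (by simp) x).hasFDerivAt
  have hWφ : ∀ x, HasFDerivAt (fun x => W x * φ x) _ x := fun x =>
    (((htd x).const_mul 2).add ((htd x).pow 3)).mul (hφd x)
  have hWφe : ∀ x, fderiv ℝ (fun x => W x * φ x) x e =
      W x * fderiv ℝ φ x e + (2 + 3 * t x ^ 2) * φ x := by
    intro x
    rw [(hWφ x).fderiv]
    simp [W, e]
    ring
  have I1 : Integrable fun x => (2 + 3 * t x ^ 2 - W x ^ 2) * φ x ^ 2 :=
    Continuous.integrable_of_hasCompactSupport (by fun_prop)
      ((hc.comp_left (g := fun y => y ^ 2) (by simp)).mul_left)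
  have I2 : Integrable fun x => W x * φ x * fderiv ℝ φ x e :=
    Continuous.integrable_of_hasCompactSupport (by fun_prop) hdc.mul_left
  have I3 : Integrable fun x => (2 + 3 * t x ^ 2) * φ x ^ 2 :=
    Continuous.integrable_of_hasCompactSupport (by fun_prop)
      ((hc.comp_left (g := fun y => y ^ 2) (by simp)).mul_left)
  have I4 : Integrable fun x => ‖gradient φ x‖ ^ 2 :=
    Continuous.integrable_of_hasCompactSupport (by fun_prop)
      (hgs.comp_left (g := fun y => ‖y‖ ^ 2) (by simp))
  have I5 : Integrable fun x => φ x ^ 2 :=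
    Continuous.integrable_of_hasCompactSupport (by fun_prop)
      (hc.comp_left (g := fun y => y ^ 2) (by simp))
  have parts : ∫ x, W x * φ x * fderiv ℝ φ x e =
      - ∫ x, fderiv ℝ (fun x => W x * φ x) x e * φ x := by
    refine integral_mul_fderiv_eq_neg_fderiv_mul_of_integrable ?_ I2 ?_ ?_ ?_
    · simp_rw [hWφe]
      exact Continuous.integrable_of_hasCompactSupport (by fun_prop) hc.mul_left
    · exact Continuous.integrable_of_hasCompactSupport (by fun_prop) hc.mul_left
    · exact fun x _ => (hWφ x).differentiableAt
    · exact fun x _ => hφ.differentiable (by simp) x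
  have parts2 : ∫ x, fderiv ℝ (fun x => W x * φ x) x e * φ x =
      (∫ x, W x * φ x * fderiv ℝ φ x e) + ∫ x, (2 + 3 * t x ^ 2) * φ x ^ 2 := by
    rw [← integral_add I2 I3]
    refine integral_congr_ae (Eventually.of_forall fun x => ?_)
    simp only [hWφe]
    ring
  have low : 7 / 5 * ∫ x, φ x ^ 2 ≤ ∫ x, (2 + 3 * t x ^ 2 - W x ^ 2) * φ x ^ 2 := by
    rw [← integral_const_mul]
    refine integral_mono (I5.const_mul _) I1 fun x => ?_
    by_cases hx : φ x = 0
    · simp [hx]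
    have h := hs x hx
    refine mul_le_mul_of_nonneg_right ?_ (sq_nonneg _)
    have h1 : t x ^ 2 ≤ 1 / 4 := by
      have h2 : -(1 / 2) ≤ t x := by simp only [t]; linarith [h.1]
      have h3 : t x ≤ 1 / 2 := by simp only [t]; linarith [h.2]
      nlinarith
    have h4 : W x ^ 2 = t x ^ 2 * (2 + t x ^ 2) ^ 2 := by simp only [W]; ring
    rw [h4]
    nlinarith [sq_nonneg (t x), mul_nonneg (sq_nonneg (t x)) (sub_nonneg.2 h1),
      mul_nonneg (mul_nonneg (sq_nonneg (t x)) (sq_nonneg (t x))) (sub_nonneg.2 h1)]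
  have up : ∫ x, (2 + 3 * t x ^ 2 - W x ^ 2) * φ x ^ 2 ≤ ∫ x, ‖gradient φ x‖ ^ 2 := by
    have I6 : Integrable fun x => (2 + 3 * t x ^ 2) * φ x ^ 2 + 2 * (W x * φ x * fderiv ℝ φ x e) :=
      I3.add (I2.const_mul 2)
    -- Subtracting this vanishing integral reduces the bound to the pointwise inequality `-W² φ² - 2
    -- W φ ∂φ ≤ (∂φ)²`, a completed square.
    have e1 : ∫ x, (2 + 3 * t x ^ 2) * φ x ^ 2 + 2 * (W x * φ x * fderiv ℝ φ x e) = 0 := by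
      rw [integral_add I3 (I2.const_mul 2), integral_const_mul]
      linarith
    rw [← sub_zero (∫ x, (2 + 3 * t x ^ 2 - W x ^ 2) * φ x ^ 2), ← e1, ← integral_sub I1 I6]
    refine integral_mono (I1.sub I6) I4 fun x => ?_
    have h1 : (fderiv ℝ φ x e) ^ 2 ≤ ‖gradient φ x‖ ^ 2 := by
      rw [sq_le_sq, abs_norm, ← inner_gradient_left]
      refine (abs_real_inner_le_norm _ _).trans ?_
      simp [e]
    simp only
    nlinarith [sq_nonneg (fderiv ℝ φ x e + W x * φ x)]
  exact low.trans up

/-- The Poincaré inequality in `H¹₀` of a subset of a strip of unit width. -/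
lemma poincare_of_mem_sobolevH10 (hΩ : ∀ x ∈ Ω, x 1 ∈ Icc (0 : ℝ) 1) {w : GradientPairs Ω}
    (hw : w ∈ sobolevH10 Ω) : 7 / 5 * ‖w.fst‖ ^ 2 ≤ ‖w.snd‖ ^ 2 := by
  have c1 : Continuous fun w : GradientPairs Ω => w.fst := (WithLp.fstL 2 ℝ _ _).continuous
  have c2 : Continuous fun w : GradientPairs Ω => w.snd := (WithLp.sndL 2 ℝ _ _).continuous
  have hcl : IsClosed {w : GradientPairs Ω | 7 / 5 * ‖w.fst‖ ^ 2 ≤ ‖w.snd‖ ^ 2} :=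
    isClosed_le ((c1.norm.pow 2).const_mul _) (c2.norm.pow 2)
  refine closure_minimal (fun w hw => ?_) hcl hw
  obtain ⟨φ, hφ, h1, h2⟩ := exists_testFunction_of_mem_span hw
  have hout : ∀ x ∉ Ω, x ∉ tsupport φ := fun x hx h => hx (hφ.2.2 h)
  rw [mem_ofPred_eq, norm_sq_eq_integral h1, norm_sq_eq_integral h2,
    setIntegral_eq_integral_of_forall_compl_eq_zero,
    setIntegral_eq_integral_of_forall_compl_eq_zero]
  · simp only [Real.norm_eq_abs, sq_abs]
    exact poincare_strip hφ.1 hφ.2.1 fun x hx => hΩ x (hφ.2.2 (subset_tsupport _ hx))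
  · intro x hx
    simp [gradient, fderiv_of_notMem_tsupport ℝ (hout x hx)]
  · intro x hx
    simp [image_eq_zero_of_notMem_tsupport (hout x hx)]

end Sobolev

/-! ### Translation estimates and the Poincaré inequality on convex sets. -/

section Translation

lemma sq_lintegral_le {α : Type*} [MeasurableSpace α] (μ : Measure α) {f : α → ℝ≥0∞}
    (hf : AEMeasurable f μ) : (∫⁻ x, f x ∂μ) ^ 2 ≤ μ univ * ∫⁻ x, f x ^ 2 ∂μ := by
  have h := ENNReal.lintegral_mul_le_Lp_mul_Lq μ (p := 2) (q := 2)
    (Real.HolderConjugate.two_two) (f := 1) (g := f) aemeasurable_const hf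
  have h2 := pow_le_pow_left' h 2
  rw [mul_pow, ← ENNReal.rpow_natCast, ← ENNReal.rpow_natCast, ← ENNReal.rpow_natCast,
    ← ENNReal.rpow_mul, ← ENNReal.rpow_mul] at h2
  simpa using h2

lemma integrable_inner_comp_add_smul {G : Plane → Plane} (hG : Integrable G)
    (hGm : StronglyMeasurable G) (w : Plane) :
    Integrable (fun p : ℝ × Plane => inner ℝ (G (p.2 + p.1 • w)) w)
      ((volume.restrict (Ioc (0 : ℝ) 1)).prod volume) := by
  have hm : StronglyMeasurable fun p : ℝ × Plane => inner ℝ (G (p.2 + p.1 • w)) w :=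
    (hGm.comp_measurable (by fun_prop)).inner stronglyMeasurable_const
  rw [integrable_prod_iff hm.aestronglyMeasurable]
  refine ⟨Eventually.of_forall fun s => ?_, ?_⟩
  · exact (hG.comp_add_right (s • w)).inner_const w
  · have : (fun s : ℝ => ∫ x, ‖inner ℝ (G (x + s • w)) w‖) =
        fun _ => ∫ x, ‖inner ℝ (G x) w‖ := by
      ext1 s
      exact integral_add_right_eq_self (fun x => ‖inner ℝ (G x) w‖) (s • w)
    rw [this]
    exact integrable_const _

/-- A function with integrable weak gradient is, along almost every segment in a convex set, the
integral of its gradient. -/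
lemma ae_sub_eq_integral_of_weakGradient {Q : Set Plane} (hQ : IsOpen Q) (hconv : Convex ℝ Q)
    {U : Plane → ℝ} {G : Plane → Plane} (hU : Integrable U) (hG : Integrable G)
    (hGm : StronglyMeasurable G)
    (h : ∀ φ, IsTestFunction Q φ → ∀ v, ∫ x, U x * fderiv ℝ φ x v = - ∫ x, inner ℝ (G x) v * φ x)
    (w : Plane) :
    ∀ᵐ x, x ∈ Q ∩ (fun x => x + w) ⁻¹' Q →
      U (x + w) - U x = ∫ s in Ioc (0 : ℝ) 1, inner ℝ (G (x + s • w)) w := by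
  have hI := integrable_inner_comp_add_smul hG hGm w
  have hI1 : Integrable fun x => ∫ s in Ioc (0 : ℝ) 1, inner ℝ (G (x + s • w)) w :=
    hI.integral_prod_right
  have hUw : Integrable fun x => U (x + w) := hU.comp_add_right w
  have hF : Integrable fun x => U (x + w) - U x -
      ∫ s in Ioc (0 : ℝ) 1, inner ℝ (G (x + s • w)) w := (hUw.sub hU).sub hI1
  have hQ' : IsOpen (Q ∩ (fun x => x + w) ⁻¹' Q) := hQ.inter (hQ.preimage (by fun_prop))
  -- The identity is tested against smooth functions: the translation moves onto `φ`, the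
  -- fundamental theorem of calculus writes `φ (x - w) - φ x` as an integral over `s`, and the weak
  -- gradient is used for each `s`.
  have key := hQ'.ae_eq_zero_of_integral_contDiff_smul_eq_zero (μ := volume)
    (f := fun x => U (x + w) - U x - ∫ s in Ioc (0 : ℝ) 1, inner ℝ (G (x + s • w)) w)
    (hF.locallyIntegrable.locallyIntegrableOn _) ?_
  · filter_upwards [key] with x hx hxQ
    exact sub_eq_zero.1 (hx hxQ)
  intro φ hφ hc hs
  obtain ⟨C, hC⟩ := hc.exists_bound_of_continuous hφ.continuous
  have hD : Continuous fun x => fderiv ℝ φ x w :=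
    (hφ.continuous_fderiv (by simp)).clm_apply continuous_const
  obtain ⟨D, hDb⟩ := (hc.fderiv_apply ℝ w).exists_bound_of_continuous hD
  have i1 : Integrable fun x => φ x * U (x + w) :=
    hUw.bdd_mul hφ.continuous.aestronglyMeasurable (Eventually.of_forall hC)
  have i2 : Integrable fun x => φ x * U x :=
    hU.bdd_mul hφ.continuous.aestronglyMeasurable (Eventually.of_forall hC)
  have i3 : Integrable fun x => φ x * ∫ s in Ioc (0 : ℝ) 1, inner ℝ (G (x + s • w)) w :=
    hI1.bdd_mul hφ.continuous.aestronglyMeasurable (Eventually.of_forall hC)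
  have i4 : Integrable fun x => φ (x - w) * U x := by
    refine hU.bdd_mul (Continuous.aestronglyMeasurable ?_) (Eventually.of_forall fun x => hC _)
    exact hφ.continuous.comp (by fun_prop)
  have ftc : ∀ x, φ (x - w) - φ x = - ∫ s in Ioc (0 : ℝ) 1, fderiv ℝ φ (x - s • w) w := by
    intro x
    have hd : ∀ s ∈ uIcc (0 : ℝ) 1, HasDerivAt (fun s : ℝ => φ (x - s • w))
        (-fderiv ℝ φ (x - s • w) w) s := by
      intro s _
      have h1 : HasDerivAt (fun s : ℝ => x - s • w) (-((1 : ℝ) • w)) s :=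
        ((hasDerivAt_id s).smul_const w).const_sub x
      have h2 := (hφ.differentiable (by simp) (x - s • w)).hasFDerivAt.comp_hasDerivAt s h1
      rw [one_smul, map_neg] at h2
      exact h2
    have h3 := intervalIntegral.integral_eq_sub_of_hasDerivAt hd
      (Continuous.intervalIntegrable (hD.comp (by fun_prop)).neg _ _)
    rw [intervalIntegral.integral_of_le zero_le_one, integral_neg] at h3
    simpa using h3.symm
  have iP : Integrable (Function.uncurry fun (s : ℝ) (x : Plane) => fderiv ℝ φ (x - s • w) w * U x)
      ((volume.restrict (Ioc (0 : ℝ) 1)).prod volume) := by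
    refine (hU.comp_snd (volume.restrict (Ioc (0 : ℝ) 1))).bdd_mul
      (f := fun p : ℝ × Plane => fderiv ℝ φ (p.2 - p.1 • w) w) (c := D)
      (Continuous.aestronglyMeasurable ?_) (Eventually.of_forall fun p => hDb _)
    exact hD.comp (f := fun p : ℝ × Plane => p.2 - p.1 • w) (by fun_prop)
  have iR : Integrable (Function.uncurry fun (s : ℝ) (x : Plane) =>
      φ x * inner ℝ (G (x + s • w)) w) ((volume.restrict (Ioc (0 : ℝ) 1)).prod volume) := by
    refine hI.bdd_mul (f := fun p : ℝ × Plane => φ p.2) (c := C)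
      (Continuous.aestronglyMeasurable ?_) (Eventually.of_forall fun p => hC _)
    exact hφ.continuous.comp continuous_snd
  -- If the support of `φ` lies in both `Q` and `Q - w`, convexity keeps the support of `φ (· - s
  -- w)` in `Q`, so this shift is an admissible test function.
  have hslice : ∀ s ∈ Ioc (0 : ℝ) 1, - ∫ x, fderiv ℝ φ (x - s • w) w * U x =
      ∫ x, φ x * inner ℝ (G (x + s • w)) w := by
    intro s hs01
    have htest : IsTestFunction Q fun x => φ (x - s • w) := by
      refine ⟨hφ.comp (by fun_prop), ?_, ?_⟩
      · exact hc.comp_homeomorph (Homeomorph.subRight (s • w))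
      · have h1 : tsupport (fun x => φ (x - s • w)) = (Homeomorph.subRight (s • w)) ⁻¹' tsupport φ :=
          tsupport_comp_eq_preimage φ (Homeomorph.subRight (s • w))
        rw [h1]
        intro x hx
        obtain ⟨hx1, hx2⟩ := hs hx
        have h2 := hconv hx1 hx2 (sub_nonneg.2 hs01.2) hs01.1.le (by ring)
        convert h2 using 1
        simp only [Homeomorph.coe_subRight]
        module
    have h1 := h _ htest w
    have h2 : ∀ x, fderiv ℝ (fun x => φ (x - s • w)) x w = fderiv ℝ φ (x - s • w) w := by
      intro x
      have h4 := fderiv_comp_add_right (𝕜 := ℝ) (f := φ) (x := x) (-(s • w))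
      simp only [← sub_eq_add_neg] at h4
      rw [h4]
    simp_rw [h2] at h1
    have h3 := integral_add_right_eq_self (μ := volume)
      (fun x => φ (x - s • w) * inner ℝ (G x) w) (s • w)
    simp only [add_sub_cancel_right] at h3
    rw [h3]
    simp_rw [mul_comm (φ _), mul_comm (fderiv ℝ φ _ _)]
    rw [h1, neg_neg]
  have e1 : ∫ x, φ x * U (x + w) = ∫ x, φ (x - w) * U x := by
    have h3 := integral_add_right_eq_self (μ := volume) (fun x => φ (x - w) * U x) w
    simpa only [add_sub_cancel_right] using h3
  have e2 : ∫ x, (φ (x - w) * U x - φ x * U x) =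
      ∫ x, φ x * ∫ s in Ioc (0 : ℝ) 1, inner ℝ (G (x + s • w)) w := by
    calc ∫ x, (φ (x - w) * U x - φ x * U x)
        = ∫ x, -∫ s in Ioc (0 : ℝ) 1, fderiv ℝ φ (x - s • w) w * U x := by
          refine integral_congr_ae (Eventually.of_forall fun x => ?_)
          simp only
          rw [← sub_mul, ftc, integral_mul_const, neg_mul]
      _ = ∫ s in Ioc (0 : ℝ) 1, -∫ x, fderiv ℝ φ (x - s • w) w * U x := by
          rw [integral_neg, integral_neg, integral_integral_swap iP]
      _ = ∫ s in Ioc (0 : ℝ) 1, ∫ x, φ x * inner ℝ (G (x + s • w)) w :=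
          setIntegral_congr_fun measurableSet_Ioc hslice
      _ = ∫ x, ∫ s in Ioc (0 : ℝ) 1, φ x * inner ℝ (G (x + s • w)) w :=
          integral_integral_swap iR
      _ = _ := by simp_rw [integral_const_mul]
  simp only [smul_eq_mul, mul_sub]
  have i5 : Integrable fun x => φ x * U (x + w) - φ x * U x := i1.sub i2
  rw [integral_sub i5 i3, integral_sub i1 i2, e1, ← integral_sub i4 i2, e2, sub_self]

/-- Cauchy-Schwarz along the segment from `x` to `x + w`, then Tonelli. By convexity each
intermediate translate of the region of integration stays in `Q`. -/
lemma lintegral_translation_le {Q : Set Plane} (hQ : IsOpen Q) (hconv : Convex ℝ Q)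
    {U : Plane → ℝ} {G : Plane → Plane} (hU : Integrable U) (hG : Integrable G)
    (hGm : StronglyMeasurable G)
    (h : ∀ φ, IsTestFunction Q φ → ∀ v, ∫ x, U x * fderiv ℝ φ x v = - ∫ x, inner ℝ (G x) v * φ x)
    (w : Plane) :
    ∫⁻ x in Q ∩ (fun x => x + w) ⁻¹' Q, ‖U (x + w) - U x‖ₑ ^ 2 ≤
      ‖w‖ₑ ^ 2 * ∫⁻ x in Q, ‖G x‖ₑ ^ 2 := by
  set Q' := Q ∩ (fun x => x + w) ⁻¹' Q with hQ'
  have hQ'm : MeasurableSet Q' := (hQ.inter (hQ.preimage (by fun_prop))).measurableSet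
  have hGe : Measurable fun p : Plane × ℝ => ‖G (p.1 + p.2 • w)‖ₑ ^ 2 :=
    ((hGm.measurable.comp (by fun_prop)).enorm).pow_const 2
  have h1 : ∀ᵐ x, x ∈ Q' → ‖U (x + w) - U x‖ₑ ^ 2 ≤
      ∫⁻ s in Ioc (0 : ℝ) 1, ‖w‖ₑ ^ 2 * ‖G (x + s • w)‖ₑ ^ 2 := by
    filter_upwards [ae_sub_eq_integral_of_weakGradient hQ hconv hU hG hGm h w] with x hx hxQ
    rw [hx hxQ]
    have hm : Measurable fun s : ℝ => ‖(inner ℝ (G (x + s • w)) w : ℝ)‖ₑ :=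
      ((hGm.measurable.comp (by fun_prop)).inner_const).enorm
    refine (pow_le_pow_left' (enorm_integral_le_lintegral_enorm _) 2).trans ?_
    refine (sq_lintegral_le _ hm.aemeasurable).trans ?_
    simp only [Measure.restrict_apply_univ, Real.volume_Ioc, sub_zero, ENNReal.ofReal_one, one_mul]
    refine lintegral_mono fun s => ?_
    rw [← mul_pow]
    gcongr
    rw [mul_comm, ← ofReal_norm, ← ofReal_norm, ← ofReal_norm,
      ← ENNReal.ofReal_mul (norm_nonneg _)]
    exact ENNReal.ofReal_le_ofReal (norm_inner_le_norm _ _)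
  have hconvQ : ∀ s ∈ Ioc (0 : ℝ) 1, ∀ x ∈ Q', x + s • w ∈ Q := by
    intro s hs x hx
    have h2 := hconv hx.1 hx.2 (sub_nonneg.2 hs.2) hs.1.le (by ring)
    convert h2 using 1
    module
  calc ∫⁻ x in Q', ‖U (x + w) - U x‖ₑ ^ 2
      ≤ ∫⁻ x in Q', ∫⁻ s in Ioc (0 : ℝ) 1, ‖w‖ₑ ^ 2 * ‖G (x + s • w)‖ₑ ^ 2 := by
        refine setLIntegral_mono_ae ?_ h1
        exact (Measurable.lintegral_prod_right' (f := fun p : Plane × ℝ =>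
          ‖w‖ₑ ^ 2 * ‖G (p.1 + p.2 • w)‖ₑ ^ 2) (hGe.const_mul _)).aemeasurable
    _ = ∫⁻ s in Ioc (0 : ℝ) 1, ∫⁻ x in Q', ‖w‖ₑ ^ 2 * ‖G (x + s • w)‖ₑ ^ 2 :=
        lintegral_lintegral_swap (hGe.const_mul _).aemeasurable
    _ ≤ ∫⁻ _ in Ioc (0 : ℝ) 1, ‖w‖ₑ ^ 2 * ∫⁻ x in Q, ‖G x‖ₑ ^ 2 := by
        refine setLIntegral_mono measurable_const fun s hs => ?_
        rw [lintegral_const_mul' _ _ (by simp), ← lintegral_indicator hQ'm,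
          ← lintegral_indicator hQ.measurableSet,
          ← lintegral_add_right_eq_self (Q.indicator fun x => ‖G x‖ₑ ^ 2) (s • w)]
        refine mul_le_mul_right (lintegral_mono fun x => ?_) _
        by_cases hx : x ∈ Q'
        · rw [indicator_of_mem hx, indicator_of_mem (hconvQ s hs x hx)]
        · rw [indicator_of_notMem hx]
          exact bot_le
    _ = _ := by simp

/-- A Poincaré inequality on convex sets, for functions with mean zero. -/
lemma lintegral_sq_le_of_setIntegral_eq_zero {Q D : Set Plane} (hQ : IsOpen Q)
    (hconv : Convex ℝ Q) (hfin : volume Q ≠ ⊤) {U : Plane → ℝ} {G : Plane → Plane}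
    (hU : Integrable U) (hUm : Measurable U) (hG : Integrable G) (hGm : StronglyMeasurable G)
    (h : ∀ φ, IsTestFunction Q φ → ∀ v, ∫ x, U x * fderiv ℝ φ x v = - ∫ x, inner ℝ (G x) v * φ x)
    (hmean : ∫ x in Q, U x = 0) (hD : MeasurableSet D)
    (hQD : ∀ x ∈ Q, ∀ w, x + w ∈ Q → w ∈ D) {δ : ℝ≥0∞} (hδ : ∀ w ∈ D, ‖w‖ₑ ^ 2 ≤ δ) :
    volume Q * ∫⁻ x in Q, ‖U x‖ₑ ^ 2 ≤ δ * volume D * ∫⁻ x in Q, ‖G x‖ₑ ^ 2 := by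
  have hQm := hQ.measurableSet
  -- As the mean vanishes, `-|Q| U x` is the integral of `U y - U x` over `y ∈ Q`; apply
  -- Cauchy-Schwarz and cancel one factor `|Q|`.
  have hpt : ∀ x, volume Q * ‖U x‖ₑ ^ 2 ≤ ∫⁻ y in Q, ‖U y - U x‖ₑ ^ 2 := by
    intro x
    rcases eq_or_ne (volume Q) 0 with h0 | h0
    · simp [h0]
    have h1 : ∫ y in Q, (U y - U x) = -(volume.real Q * U x) := by
      rw [integral_sub hU.integrableOn (integrableOn_const hfin), hmean]
      simp
    have h2 : volume Q * ‖U x‖ₑ ≤ ∫⁻ y in Q, ‖U y - U x‖ₑ := by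
      refine le_trans (le_of_eq ?_) (enorm_integral_le_lintegral_enorm _)
      rw [h1, enorm_neg, enorm_mul, Real.enorm_of_nonneg measureReal_nonneg,
        ofReal_measureReal hfin]
    have h3 := (pow_le_pow_left' h2 2).trans
      (sq_lintegral_le (volume.restrict Q) (hUm.sub_const (U x)).enorm.aemeasurable)
    rw [Measure.restrict_apply_univ, mul_pow, sq (volume Q), mul_assoc] at h3
    exact (ENNReal.mul_le_mul_iff_right h0 hfin).1 h3
  -- Substituting `y = x + w` and swapping the integrals leaves, for each `w`, a translation
  -- estimate; only differences `w ∈ D` contribute.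
  let F : Plane → Plane → ℝ≥0∞ := fun x w =>
    (Q ∩ (fun x => x + w) ⁻¹' Q).indicator (fun x => ‖U (x + w) - U x‖ₑ ^ 2) x
  have hFm : Measurable (Function.uncurry F) := by
    have : Function.uncurry F = ({p : Plane × Plane | p.1 ∈ Q ∧ p.1 + p.2 ∈ Q}).indicator
        (fun p => ‖U (p.1 + p.2) - U p.1‖ₑ ^ 2) := by
      ext p
      simp only [F, Function.uncurry, indicator]
      rfl
    rw [this]
    refine Measurable.indicator ?_ ?_
    · exact (((hUm.comp (by fun_prop)).sub (hUm.comp measurable_fst)).enorm).pow_const 2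
    · exact (measurable_fst hQm).inter ((measurable_fst.add measurable_snd) hQm)
  calc volume Q * ∫⁻ x in Q, ‖U x‖ₑ ^ 2 = ∫⁻ x in Q, volume Q * ‖U x‖ₑ ^ 2 :=
        (lintegral_const_mul' _ _ hfin).symm
    _ ≤ ∫⁻ x in Q, ∫⁻ y in Q, ‖U y - U x‖ₑ ^ 2 := lintegral_mono hpt
    _ = ∫⁻ x, ∫⁻ w, F x w := by
        rw [← lintegral_indicator hQm]
        refine lintegral_congr fun x => ?_
        by_cases hx : x ∈ Q
        · rw [indicator_of_mem hx, ← lintegral_indicator hQm,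
            ← lintegral_add_left_eq_self _ x]
          refine lintegral_congr fun w => ?_
          by_cases hw : x + w ∈ Q
          · rw [indicator_of_mem hw]
            simp only [F]
            rw [indicator_of_mem (show x ∈ Q ∩ (fun x => x + w) ⁻¹' Q from ⟨hx, hw⟩), add_comm]
          · rw [indicator_of_notMem hw]
            exact (indicator_of_notMem (fun h => hw h.2) _).symm
        · rw [indicator_of_notMem hx]
          have : ∀ w, F x w = 0 := fun w => indicator_of_notMem (fun h => hx h.1) _
          simp [this]
    _ = ∫⁻ w, ∫⁻ x, F x w := lintegral_lintegral_swap hFm.aemeasurable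
    _ ≤ ∫⁻ w, D.indicator (fun _ => δ * ∫⁻ x in Q, ‖G x‖ₑ ^ 2) w := by
        refine lintegral_mono fun w => ?_
        by_cases hw : w ∈ D
        · rw [indicator_of_mem hw]
          simp only [F]
          rw [lintegral_indicator (hQ.inter (hQ.preimage (by fun_prop))).measurableSet]
          refine (lintegral_translation_le hQ hconv hU hG hGm h w).trans ?_
          gcongr
          exact hδ w hw
        · have : ∀ x, F x w = 0 :=
            fun x => indicator_of_notMem (fun h => hw (hQD x h.1 w h.2)) _
          simp [this]
    _ = _ := by
        rw [lintegral_indicator hD, setLIntegral_const]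
        ring

end Translation

/-! ### Rectangles, and the compact embedding of `H¹` on finite unions of them. -/

section Boxes

/-- The open rectangle `(a, b) × (c, d)`. -/
def openBox (a b c d : ℝ) : Set Plane :=
  {p | p 0 ∈ Ioo a b ∧ p 1 ∈ Ioo c d}

lemma isOpen_openBox (a b c d : ℝ) : IsOpen (openBox a b c d) :=
  (isOpen_Ioo.preimage (f := fun p : Plane => p 0) (by fun_prop)).inter
    (isOpen_Ioo.preimage (f := fun p : Plane => p 1) (by fun_prop))

lemma convex_openBox (a b c d : ℝ) : Convex ℝ (openBox a b c d) := by
  have h0 : Convex ℝ ((EuclideanSpace.proj (0 : Fin 2) : Plane →L[ℝ] ℝ) ⁻¹' Ioo a b) :=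
    (convex_Ioo a b).linear_preimage (EuclideanSpace.proj (0 : Fin 2) : Plane →L[ℝ] ℝ).toLinearMap
  have h1 : Convex ℝ ((EuclideanSpace.proj (1 : Fin 2) : Plane →L[ℝ] ℝ) ⁻¹' Ioo c d) :=
    (convex_Ioo c d).linear_preimage (EuclideanSpace.proj (1 : Fin 2) : Plane →L[ℝ] ℝ).toLinearMap
  exact h0.inter h1

lemma volume_openBox (a b c d : ℝ) :
    volume (openBox a b c d) = ENNReal.ofReal (b - a) * ENNReal.ofReal (d - c) := by
  have h1 : openBox a b c d = (MeasurableEquiv.toLp 2 (Fin 2 → ℝ)).symm ⁻¹'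
      (univ.pi ![Ioo a b, Ioo c d]) := by
    ext p
    simp [openBox, Set.mem_pi, Fin.forall_fin_two]
  rw [h1, (EuclideanSpace.volume_preserving_symm_measurableEquiv_toLp (Fin 2)).measure_preimage,
    volume_pi_pi]
  · simp
  · refine (MeasurableSet.univ_pi fun i => ?_).nullMeasurableSet
    fin_cases i <;> exact measurableSet_Ioo

lemma volume_setOf_coord_eq (i : Fin 2) (t : ℝ) : volume {p : Plane | p i = t} = 0 := by
  have h1 : {p : Plane | p i = t} = (MeasurableEquiv.toLp 2 (Fin 2 → ℝ)).symm ⁻¹'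
      {q | q i = t} := by
    ext p
    simp
  rw [h1, (EuclideanSpace.volume_preserving_symm_measurableEquiv_toLp (Fin 2)).measure_preimage]
  · exact Measure.pi_hyperplane (α := fun _ : Fin 2 => ℝ) (fun _ => volume) i t
  · exact (measurableSet_eq_fun (measurable_pi_apply i) measurable_const).nullMeasurableSet

variable {Ω : Set Plane}

/-- The Poincaré inequality on a rectangle for functions with mean zero there. -/
lemma lintegral_openBox_sq_le {a b c d : ℝ} (hab : a < b) (hcd : c < d)
    (hQΩ : openBox a b c d ⊆ Ω) {u : GradientPairs Ω} (hu : u ∈ sobolevH1 Ω)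
    (hmean : ∫ x in openBox a b c d, u.fst x = 0) :
    ∫⁻ x in openBox a b c d, ‖u.fst x‖ₑ ^ 2 ≤
      ENNReal.ofReal (4 * ((b - a) ^ 2 + (d - c) ^ 2)) *
        ∫⁻ x in openBox a b c d, ‖u.snd x‖ₑ ^ 2 := by
  set Q := openBox a b c d with hQ
  have hQo : IsOpen Q := isOpen_openBox a b c d
  have hQm := hQo.measurableSet
  have hvol : volume Q = ENNReal.ofReal ((b - a) * (d - c)) := by
    rw [hQ, volume_openBox, ← ENNReal.ofReal_mul (by linarith)]
  have hfin : volume Q ≠ ⊤ := by rw [hvol]; exact ENNReal.ofReal_ne_top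
  have hpos : volume Q ≠ 0 := by
    rw [hvol, Ne, ENNReal.ofReal_eq_zero, not_le]
    exact mul_pos (by linarith) (by linarith)
  have : IsFiniteMeasure (volume.restrict Q) := ⟨by simpa using hfin.lt_top⟩
  have hle : volume.restrict Q ≤ volume.restrict Ω := Measure.restrict_mono hQΩ le_rfl
  have hUi : Integrable (Q.indicator u.fst) :=
    IntegrableOn.integrable_indicator
      (((Lp.memLp u.fst).mono_measure hle).integrable one_le_two) hQm
  have hGi : Integrable (Q.indicator u.snd) :=
    IntegrableOn.integrable_indicator
      (((Lp.memLp u.snd).mono_measure hle).integrable one_le_two) hQm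
  have hUm : Measurable (Q.indicator u.fst) :=
    (Lp.stronglyMeasurable u.fst).measurable.indicator hQm
  have hGm : StronglyMeasurable (Q.indicator u.snd) :=
    (Lp.stronglyMeasurable u.snd).indicator hQm
  have hweak : ∀ φ, IsTestFunction Q φ → ∀ v, ∫ x, Q.indicator u.fst x * fderiv ℝ φ x v =
      - ∫ x, inner ℝ (Q.indicator u.snd x) v * φ x := by
    intro φ hφ v
    have hout : ∀ x ∉ Q, x ∉ tsupport φ := fun x hx h => hx (hφ.2.2 h)
    have h1 := hu φ ⟨hφ.1, hφ.2.1, hφ.2.2.trans hQΩ⟩ v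
    rw [setIntegral_eq_integral_of_forall_compl_eq_zero,
      setIntegral_eq_integral_of_forall_compl_eq_zero] at h1
    · convert h1 using 2
      · ext x
        by_cases hx : x ∈ Q
        · rw [indicator_of_mem hx]
        · rw [fderiv_of_notMem_tsupport ℝ (hout x hx)]
          simp
      · congr 1
        ext x
        by_cases hx : x ∈ Q
        · rw [indicator_of_mem hx]
        · rw [image_eq_zero_of_notMem_tsupport (hout x hx)]
          simp
    · intro x hx
      rw [image_eq_zero_of_notMem_tsupport (hout x fun h => hx (hQΩ h)), mul_zero]
    · intro x hx
      rw [fderiv_of_notMem_tsupport ℝ (hout x fun h => hx (hQΩ h))]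
      simp
  -- Differences of points of `Q` fill a box with doubled sides, of area `4 |Q|`: this is the factor
  -- `4`, and `|Q|` cancels.
  have key := lintegral_sq_le_of_setIntegral_eq_zero
    (D := openBox (-(b - a)) (b - a) (-(d - c)) (d - c))
    (δ := ENNReal.ofReal ((b - a) ^ 2 + (d - c) ^ 2)) hQo (convex_openBox a b c d) hfin hUi hUm
    hGi hGm hweak (by rwa [setIntegral_indicator hQm, inter_self])
    (isOpen_openBox _ _ _ _).measurableSet ?_ ?_
  · have e1 : ∫⁻ x in Q, ‖Q.indicator u.fst x‖ₑ ^ 2 = ∫⁻ x in Q, ‖u.fst x‖ₑ ^ 2 :=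
      setLIntegral_congr_fun hQm fun x hx => by simp only [indicator_of_mem hx]
    have e2 : ∫⁻ x in Q, ‖Q.indicator u.snd x‖ₑ ^ 2 = ∫⁻ x in Q, ‖u.snd x‖ₑ ^ 2 :=
      setLIntegral_congr_fun hQm fun x hx => by simp only [indicator_of_mem hx]
    have e3 : ENNReal.ofReal ((b - a) ^ 2 + (d - c) ^ 2) *
        volume (openBox (-(b - a)) (b - a) (-(d - c)) (d - c)) =
        volume Q * ENNReal.ofReal (4 * ((b - a) ^ 2 + (d - c) ^ 2)) := by
      rw [volume_openBox, hvol, ← ENNReal.ofReal_mul (by linarith),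
        ← ENNReal.ofReal_mul (by positivity),
        ← ENNReal.ofReal_mul (mul_nonneg (by linarith) (by linarith))]
      congr 1
      ring
    rw [e1, e2, e3, mul_assoc] at key
    exact (ENNReal.mul_le_mul_iff_right hpos hfin).1 key
  · rintro x ⟨⟨hx1, hx2⟩, hx3, hx4⟩ w ⟨⟨hw1, hw2⟩, hw3, hw4⟩
    simp only [PiLp.add_apply] at hw1 hw2 hw3 hw4
    exact ⟨⟨by linarith, by linarith⟩, by linarith, by linarith⟩
  · rintro w ⟨⟨hw1, hw2⟩, hw3, hw4⟩
    rw [← ofReal_norm, ← ENNReal.ofReal_pow (norm_nonneg _), EuclideanSpace.real_norm_sq_eq,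
      Fin.sum_univ_two]
    refine ENNReal.ofReal_le_ofReal (add_le_add (sq_le_sq' hw1.le hw2.le) (sq_le_sq' hw3.le hw4.le))

/-- The functional `u ↦ ∫_Q u` on pairs `(u, ∇u)`. -/
noncomputable def meanFunctional (Ω : Set Plane) {Q : Set Plane} (hQ : MeasurableSet Q)
    (hfin : volume Q ≠ ⊤) : GradientPairs Ω →L[ℝ] ℝ :=
  (innerSL ℝ (indicatorConstLp 2 hQ
    (ne_top_of_le_ne_top hfin (Measure.restrict_apply_le Ω Q)) (1 : ℝ))).comp (WithLp.fstL 2 ℝ _ _)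

lemma meanFunctional_apply {Q : Set Plane} (hQ : MeasurableSet Q) (hfin : volume Q ≠ ⊤)
    (hQΩ : Q ⊆ Ω) (u : GradientPairs Ω) : meanFunctional Ω hQ hfin u = ∫ x in Q, u.fst x := by
  have h : meanFunctional Ω hQ hfin u = inner ℝ (indicatorConstLp 2 hQ
    (ne_top_of_le_ne_top hfin (Measure.restrict_apply_le Ω Q)) (1 : ℝ)) u.fst := rfl
  rw [h, L2.inner_indicatorConstLp_one, Measure.restrict_restrict hQ, inter_eq_left.2 hQΩ]

/-- On a finite-codimensional space of functions the Poincaré constant of a rectangle is as small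
as desired. -/
lemma exists_finset_lintegral_openBox_sq_le (n : ℕ) :
    ∀ {a b c d : ℝ}, a < b → c < d → openBox a b c d ⊆ Ω →
      ∃ S : Finset (GradientPairs Ω →L[ℝ] ℝ), ∀ u ∈ sobolevH1 Ω, (∀ L ∈ S, L u = 0) →
        ∫⁻ x in openBox a b c d, ‖u.fst x‖ₑ ^ 2 ≤
          ENNReal.ofReal (4 * ((b - a) ^ 2 + (d - c) ^ 2) * (1 / 4) ^ n) *
            ∫⁻ x in openBox a b c d, ‖u.snd x‖ₑ ^ 2 := by
  classical
  induction n with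
  | zero =>
    intro a b c d hab hcd hQ
    have hfin : volume (openBox a b c d) ≠ ⊤ := by
      rw [volume_openBox]
      exact ENNReal.mul_ne_top ENNReal.ofReal_ne_top ENNReal.ofReal_ne_top
    refine ⟨{meanFunctional Ω (isOpen_openBox a b c d).measurableSet hfin}, fun u hu hL => ?_⟩
    have h := hL _ (Finset.mem_singleton_self _)
    rw [meanFunctional_apply _ _ hQ] at h
    simpa using lintegral_openBox_sq_le hab hcd hQ hu h
  | succ n ih =>
    intro a b c d hab hcd hQ
    -- Halving both sides gives four boxes whose squared diagonals are a quarter of the original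
    -- one. The functionals of all four are imposed together, and the dividing lines are null.
    set m := (a + b) / 2 with hm
    set k := (c + d) / 2 with hk
    have s1 : openBox a m c k ⊆ openBox a b c d := fun x hx =>
      ⟨⟨hx.1.1, by linarith [hx.1.2]⟩, hx.2.1, by linarith [hx.2.2]⟩
    have s2 : openBox m b c k ⊆ openBox a b c d := fun x hx =>
      ⟨⟨by linarith [hx.1.1], hx.1.2⟩, hx.2.1, by linarith [hx.2.2]⟩
    have s3 : openBox a m k d ⊆ openBox a b c d := fun x hx =>
      ⟨⟨hx.1.1, by linarith [hx.1.2]⟩, by linarith [hx.2.1], hx.2.2⟩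
    have s4 : openBox m b k d ⊆ openBox a b c d := fun x hx =>
      ⟨⟨by linarith [hx.1.1], hx.1.2⟩, by linarith [hx.2.1], hx.2.2⟩
    obtain ⟨S1, h1⟩ := ih (a := a) (b := m) (c := c) (d := k) (by linarith) (by linarith)
      (s1.trans hQ)
    obtain ⟨S2, h2⟩ := ih (a := m) (b := b) (c := c) (d := k) (by linarith) (by linarith)
      (s2.trans hQ)
    obtain ⟨S3, h3⟩ := ih (a := a) (b := m) (c := k) (d := d) (by linarith) (by linarith)
      (s3.trans hQ)
    obtain ⟨S4, h4⟩ := ih (a := m) (b := b) (c := k) (d := d) (by linarith) (by linarith)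
      (s4.trans hQ)
    refine ⟨S1 ∪ S2 ∪ S3 ∪ S4, fun u hu hL => ?_⟩
    have h1 := h1 u hu fun L h => hL L (by simp [h])
    have h2 := h2 u hu fun L h => hL L (by simp [h])
    have h3 := h3 u hu fun L h => hL L (by simp [h])
    have h4 := h4 u hu fun L h => hL L (by simp [h])
    set C := ENNReal.ofReal (4 * ((b - a) ^ 2 + (d - c) ^ 2) * (1 / 4) ^ (n + 1)) with hC
    have c1 : 4 * ((m - a) ^ 2 + (k - c) ^ 2) * (1 / 4) ^ n =
        4 * ((b - a) ^ 2 + (d - c) ^ 2) * (1 / 4) ^ (n + 1) := by rw [pow_succ]; ring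
    have c2 : 4 * ((b - m) ^ 2 + (k - c) ^ 2) * (1 / 4) ^ n =
        4 * ((b - a) ^ 2 + (d - c) ^ 2) * (1 / 4) ^ (n + 1) := by rw [pow_succ]; ring
    have c3 : 4 * ((m - a) ^ 2 + (d - k) ^ 2) * (1 / 4) ^ n =
        4 * ((b - a) ^ 2 + (d - c) ^ 2) * (1 / 4) ^ (n + 1) := by rw [pow_succ]; ring
    have c4 : 4 * ((b - m) ^ 2 + (d - k) ^ 2) * (1 / 4) ^ n =
        4 * ((b - a) ^ 2 + (d - c) ^ 2) * (1 / 4) ^ (n + 1) := by rw [pow_succ]; ring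
    rw [c1] at h1
    rw [c2] at h2
    rw [c3] at h3
    rw [c4] at h4
    have hae : openBox a b c d ≤ᵐ[volume]
        (openBox a m c k ∪ openBox m b c k ∪ openBox a m k d ∪ openBox m b k d : Set Plane) := by
      have n1 : ∀ᵐ p : Plane, p 0 ≠ m := by
        simpa [ae_iff] using volume_setOf_coord_eq 0 m
      have n2 : ∀ᵐ p : Plane, p 1 ≠ k := by
        simpa [ae_iff] using volume_setOf_coord_eq 1 k
      filter_upwards [n1, n2] with p hp1 hp2 hp
      obtain ⟨⟨q1, q2⟩, q3, q4⟩ := hp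
      rcases lt_or_gt_of_ne hp1 with h | h <;> rcases lt_or_gt_of_ne hp2 with h' | h'
      · exact Or.inl (Or.inl (Or.inl ⟨⟨q1, h⟩, q3, h'⟩))
      · exact Or.inl (Or.inr ⟨⟨q1, h⟩, h', q4⟩)
      · exact Or.inl (Or.inl (Or.inr ⟨⟨h, q2⟩, q3, h'⟩))
      · exact Or.inr ⟨⟨h, q2⟩, h', q4⟩
    have disj : ∀ {a b c d a' b' c' d' : ℝ}, b ≤ a' ∨ d ≤ c' →
        Disjoint (openBox a b c d) (openBox a' b' c' d') := by
      intro a b c d a' b' c' d' h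
      rw [Set.disjoint_left]
      rintro x ⟨⟨_, x1⟩, _, x2⟩ ⟨⟨y1, _⟩, y2, _⟩
      rcases h with h | h <;> linarith
    have mb : ∀ a b c d, MeasurableSet (openBox a b c d) :=
      fun a b c d => (isOpen_openBox a b c d).measurableSet
    have sumG : ∀ f : Plane → ℝ≥0∞, ∫⁻ x in openBox a m c k ∪ openBox m b c k ∪
        openBox a m k d ∪ openBox m b k d, f x = (∫⁻ x in openBox a m c k, f x) +
          (∫⁻ x in openBox m b c k, f x) + (∫⁻ x in openBox a m k d, f x) +
          (∫⁻ x in openBox m b k d, f x) := by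
      intro f
      rw [lintegral_union (mb _ _ _ _), lintegral_union (mb _ _ _ _), lintegral_union (mb _ _ _ _)]
      · exact disj (Or.inl le_rfl)
      · exact Disjoint.union_left (disj (Or.inr le_rfl)) (disj (Or.inr le_rfl))
      · exact Disjoint.union_left (Disjoint.union_left (disj (Or.inr le_rfl))
          (disj (Or.inr le_rfl))) (disj (Or.inl le_rfl))
    calc ∫⁻ x in openBox a b c d, ‖u.fst x‖ₑ ^ 2
        ≤ ∫⁻ x in openBox a m c k ∪ openBox m b c k ∪ openBox a m k d ∪ openBox m b k d,
            ‖u.fst x‖ₑ ^ 2 := lintegral_mono' (Measure.restrict_mono_ae hae) le_rfl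
      _ ≤ C * ∫⁻ x in openBox a m c k ∪ openBox m b c k ∪ openBox a m k d ∪ openBox m b k d,
            ‖u.snd x‖ₑ ^ 2 := by
          rw [sumG, sumG, mul_add, mul_add, mul_add]
          exact add_le_add (add_le_add (add_le_add h1 h2) h3) h4
      _ ≤ _ := by
          gcongr
          exact union_subset (union_subset (union_subset s1 s2) s3) s4

lemma enorm_sq_eq_lintegral {F : Type*} [NormedAddCommGroup F] {μ : Measure Plane} (f : Lp F 2 μ) :
    ENNReal.ofReal (‖f‖ ^ 2) = ∫⁻ x, ‖f x‖ₑ ^ 2 ∂μ := by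
  have h := eLpNorm_nnreal_pow_eq_lintegral (f := f) (μ := μ) (p := 2) two_ne_zero
  rw [ENNReal.ofReal_pow (norm_nonneg _), Lp.norm_def, ENNReal.ofReal_toReal (Lp.eLpNorm_ne_top f)]
  simpa using h

/-- `H¹` of a set covered, up to a null set, by finitely many open rectangles contained in it embeds
compactly into `L²`. -/
lemma compactlyEmbedded_sobolevH1 {ι : Type*} [Fintype ι]
    {a b c d : ι → ℝ} (hab : ∀ i, a i < b i) (hcd : ∀ i, c i < d i)
    (hsub : ∀ i, openBox (a i) (b i) (c i) (d i) ⊆ Ω)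
    (hcov : Ω ≤ᵐ[volume] (⋃ i, openBox (a i) (b i) (c i) (d i) : Set Plane)) :
    CompactlyEmbedded (sobolevH1 Ω) := by
  classical
  intro ε hε
  -- Each rectangle is estimated separately by the energy on all of `Ω`; overlaps only enlarge `M`,
  -- which the factor `(1 / 4) ^ n` absorbs.
  set M : ℝ := ∑ i, 4 * ((b i - a i) ^ 2 + (d i - c i) ^ 2) with hM
  have hM0 : 0 ≤ M := Finset.sum_nonneg fun i _ => by positivity
  obtain ⟨n, hn⟩ := exists_pow_lt_of_lt_one (show 0 < ε / (M + 1) by positivity)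
    (show (1 / 4 : ℝ) < 1 by norm_num)
  have hMn : M * (1 / 4) ^ n ≤ ε := by
    rw [lt_div_iff₀ (by positivity)] at hn
    nlinarith [pow_pos (show (0 : ℝ) < 1 / 4 by norm_num) n]
  choose S hS using fun i =>
    exists_finset_lintegral_openBox_sq_le n (hab i) (hcd i) (hsub i)
  refine ⟨Finset.univ.biUnion S, fun u hu hL => ?_⟩
  have h1 := fun i => hS i u hu fun L hLi => hL L (Finset.mem_biUnion.2 ⟨i, Finset.mem_univ i, hLi⟩)
  rw [← ENNReal.ofReal_le_ofReal_iff (by positivity), ENNReal.ofReal_mul hε.le,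
    enorm_sq_eq_lintegral, enorm_sq_eq_lintegral]
  calc ∫⁻ x in Ω, ‖u.fst x‖ₑ ^ 2
      ≤ ∫⁻ x in ⋃ i, openBox (a i) (b i) (c i) (d i), ‖u.fst x‖ₑ ^ 2 :=
        lintegral_mono' (Measure.restrict_mono_ae hcov) le_rfl
    _ ≤ ∑ i, ∫⁻ x in openBox (a i) (b i) (c i) (d i), ‖u.fst x‖ₑ ^ 2 := by
        refine (lintegral_iUnion_le _ _).trans ?_
        rw [tsum_fintype]
    _ ≤ ∑ i, ENNReal.ofReal (4 * ((b i - a i) ^ 2 + (d i - c i) ^ 2) * (1 / 4) ^ n) *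
          ∫⁻ x in Ω, ‖u.snd x‖ₑ ^ 2 := by
        refine Finset.sum_le_sum fun i _ => (h1 i).trans ?_
        gcongr
        exact hsub i
    _ = ENNReal.ofReal (M * (1 / 4) ^ n) * ∫⁻ x in Ω, ‖u.snd x‖ₑ ^ 2 := by
        rw [← Finset.sum_mul, ← ENNReal.ofReal_sum_of_nonneg (fun i _ => by positivity),
          ← Finset.sum_mul]
    _ ≤ _ := by gcongr

end Boxes

/-! ### Lipschitz charts at flat boundary points and at right-angled corners. -/

section LipschitzCharts

/-- Near `z` and in suitable Cartesian coordinates, `Ω` is the region strictly above the graph of a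
Lipschitz function. -/
def HasLipschitzChart (Ω : Set Plane) (z : Plane) : Prop :=
  ∃ (e : Plane ≃ₗᵢ[ℝ] Plane) (g : ℝ → ℝ) (K : ℝ≥0) (r : ℝ),
    LipschitzWith K g ∧ 0 < r ∧ ∀ p ∈ Metric.ball z r, (p ∈ Ω ↔ g (e p 0) < e p 1)

lemma exists_rotation {a b : ℝ} (h : a ^ 2 + b ^ 2 = 1) :
    ∃ e : Plane ≃ₗᵢ[ℝ] Plane, ∀ p, e p 0 = b * p 0 - a * p 1 ∧ e p 1 = a * p 0 + b * p 1 := by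
  let f : Plane →ₗ[ℝ] Plane :=
    { toFun := fun p => !₂[b * p 0 - a * p 1, a * p 0 + b * p 1]
      map_add' := fun p q => by
        ext i; fin_cases i <;> simp <;> ring
      map_smul' := fun c p => by
        ext i; fin_cases i <;> simp <;> ring }
  have hf : ∀ p, f p 0 = b * p 0 - a * p 1 ∧ f p 1 = a * p 0 + b * p 1 := fun p =>
    ⟨rfl, rfl⟩
  let f' : Plane →ₗᵢ[ℝ] Plane :=
    { f with
      norm_map' := fun p => by
        rw [← sq_eq_sq₀ (norm_nonneg _) (norm_nonneg _), EuclideanSpace.real_norm_sq_eq,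
          EuclideanSpace.real_norm_sq_eq, Fin.sum_univ_two, Fin.sum_univ_two, (hf p).1, (hf p).2]
        linear_combination (p 0 ^ 2 + p 1 ^ 2) * h }
  exact ⟨f'.toLinearIsometryEquiv rfl, hf⟩

lemma HasLipschitzChart.of_halfPlane {Ω : Set Plane} {z : Plane} {a b t : ℝ}
    (hab : a ^ 2 + b ^ 2 = 1) (h : ∀ᶠ p in 𝓝 z, (p ∈ Ω ↔ t < a * p 0 + b * p 1)) :
    HasLipschitzChart Ω z := by
  obtain ⟨e, he⟩ := exists_rotation hab
  obtain ⟨r, hr, h⟩ := Metric.eventually_nhds_iff_ball.1 h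
  refine ⟨e, fun _ => t, 0, r, LipschitzWith.const t, hr, fun p hp => ?_⟩
  rw [h p hp, (he p).2]

/-- Turning the diagonal direction `(s₁, s₂)` upright makes the corner the graph of `±|t|`, with
slope one. The sign `σ = 1` gives a quadrant (convex corner), `σ = -1` the union of two half-planes
(re-entrant corner), by `abs_sub_lt_add_iff` and `neg_abs_sub_lt_add_iff`. -/
lemma HasLipschitzChart.of_corner {Ω : Set Plane} {z : Plane} {s₁ s₂ σ : ℝ} (h₁ : s₁ ^ 2 = 1)
    (h₂ : s₂ ^ 2 = 1) (hσ : |σ| = 1)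
    (h : ∀ᶠ p in 𝓝 z, (p ∈ Ω ↔ σ * |s₁ * (p 0 - z 0) - s₂ * (p 1 - z 1)| <
      s₁ * (p 0 - z 0) + s₂ * (p 1 - z 1))) : HasLipschitzChart Ω z := by
  have hs : √2 ^ 2 = (2 : ℝ) := Real.sq_sqrt zero_le_two
  have hs0 : (0 : ℝ) < √2 := by positivity
  obtain ⟨e, he⟩ := exists_rotation (a := s₁ / √2) (b := s₂ / √2) (by
    rw [div_pow, div_pow, h₁, h₂, hs]; norm_num)
  obtain ⟨r, hr, h⟩ := Metric.eventually_nhds_iff_ball.1 h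
  refine ⟨e, fun t => e z 1 + σ * |t - e z 0|, 1, r, ?_, hr, fun p hp => ?_⟩
  · refine LipschitzWith.of_dist_le_mul fun x y => ?_
    rw [Real.dist_eq, Real.dist_eq, add_sub_add_left_eq_sub, ← mul_sub, abs_mul, hσ, one_mul,
      NNReal.coe_one, one_mul]
    refine (abs_abs_sub_abs_le _ _).trans (le_of_eq ?_)
    congr 1
    ring
  · have e1 : √2 * (e p 1 - e z 1) = s₁ * (p 0 - z 0) + s₂ * (p 1 - z 1) := by
      rw [(he p).2, (he z).2]
      field_simp
      ring
    have e2 : √2 * (e p 0 - e z 0) =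
        s₁ * s₂ * (s₁ * (p 0 - z 0) - s₂ * (p 1 - z 1)) := by
      rw [(he p).1, (he z).1]
      field_simp
      linear_combination (-s₂ * (p 0 - z 0)) * h₁ + s₁ * (p 1 - z 1) * h₂
    have e3 : |s₁ * s₂| = 1 := by
      rw [← sq_eq_sq₀ (abs_nonneg _) zero_le_one, sq_abs, mul_pow, h₁, h₂]; norm_num
    have e4 : √2 * |e p 0 - e z 0| = |s₁ * (p 0 - z 0) - s₂ * (p 1 - z 1)| := by
      rw [← one_mul |s₁ * _ - _|, ← e3, ← abs_mul, ← e2, abs_mul, abs_of_pos hs0]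
    rw [h p hp, ← e1, ← e4, ← mul_lt_mul_iff_right₀ hs0 (b := e z 1 + _)]
    constructor <;> intro h <;> nlinarith

lemma abs_sub_lt_add_iff {α β : ℝ} : |α - β| < α + β ↔ 0 < α ∧ 0 < β := by
  rw [abs_lt]
  constructor
  · rintro ⟨h1, h2⟩; constructor <;> linarith
  · rintro ⟨h1, h2⟩; constructor <;> linarith

lemma neg_abs_sub_lt_add_iff {α β : ℝ} : -|α - β| < α + β ↔ 0 < α ∨ 0 < β := by
  rw [neg_lt, lt_abs]
  constructor
  · rintro (h | h)
    · left; linarith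
    · right; linarith
  · rintro (h | h)
    · left; linarith
    · right; linarith

/-- A set which near `z` is the region under a step function with a jump at `z 0`. -/
lemma HasLipschitzChart.of_step {Ω : Set Plane} {z : Plane} {s m M : ℝ} (hs : s ^ 2 = 1)
    (hm : 0 ≤ m) (hmM : m ≤ M) (hz : z ∈ closure Ω) (hzΩ : z ∉ Ω)
    (h : ∀ᶠ p in 𝓝 z, (p ∈ Ω ↔ 0 < p 1 ∧ (p 1 < m ∨ (0 < s * (p 0 - z 0) ∧ p 1 < M)))) :
    HasLipschitzChart Ω z := by
  have c1 : ContinuousAt (fun p : Plane => p 1) z := by fun_prop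
  have lt_of : ∀ {t}, z 1 < t → ∀ᶠ p in 𝓝 z, p 1 < t := fun h => c1.eventually_lt_const h
  have gt_of : ∀ {t}, t < z 1 → ∀ᶠ p in 𝓝 z, t < p 1 := fun h => c1.eventually_const_lt h
  -- Excludes the positions and degenerate heights for which `Ω` would be empty near `z`.
  have hne : ¬ ∀ᶠ p in 𝓝 z, p ∉ Ω := by
    intro hev
    exact (mem_closure_iff_frequently.1 hz) hev
  have hzz := (not_congr h.self_of_nhds).1 hzΩ
  -- The boundary can only meet `z` at height `0`, `m` or `M`, or on the vertical jump between `m`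
  -- and `M`; all other positions contradict `hne` or `hzΩ`.
  rcases lt_trichotomy (z 1) 0 with h0 | h0 | h0
  · refine absurd ?_ hne
    filter_upwards [h, lt_of h0] with p hp hp1 hpΩ
    linarith [(hp.1 hpΩ).1]
  · rcases hm.lt_or_eq with hm | rfl
    · refine of_halfPlane (a := 0) (b := 1) (t := 0) (by norm_num) ?_
      filter_upwards [h, lt_of (h0.trans_lt hm)] with p hp hp1
      rw [hp]
      simp [hp1]
    · rcases hmM.lt_or_eq with hM | rfl
      · refine of_corner (s₁ := s) (s₂ := 1) (σ := 1) hs (by norm_num) (by norm_num) ?_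
        filter_upwards [h, lt_of (h0.trans_lt hM)] with p hp hp1
        rw [hp, one_mul, abs_sub_lt_add_iff, h0]
        constructor
        · rintro ⟨h1, h2 | h2⟩
          · linarith
          · exact ⟨h2.1, by linarith⟩
        · rintro ⟨h1, h2⟩
          exact ⟨by linarith, Or.inr ⟨h1, hp1⟩⟩
      · refine absurd ?_ hne
        filter_upwards [h] with p hp hpΩ
        rcases hp.1 hpΩ with ⟨h1, h2 | h2⟩
        · linarith
        · linarith [h2.2]
  · rcases lt_trichotomy (z 1) m with h1 | h1 | h1
    · exact absurd ⟨h0, Or.inl h1⟩ hzz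
    · rcases hmM.lt_or_eq with hM | rfl
      · refine of_corner (s₁ := s) (s₂ := -1) (σ := -1) hs (by norm_num) (by norm_num) ?_
        filter_upwards [h, lt_of (h1.trans_lt hM), gt_of h0] with p hp hp1 hp2
        rw [hp, neg_one_mul, neg_abs_sub_lt_add_iff, ← h1]
        constructor
        · rintro ⟨_, h2 | h2⟩
          · right; linarith
          · exact Or.inl h2.1
        · rintro (h2 | h2)
          · exact ⟨hp2, Or.inr ⟨h2, hp1⟩⟩
          · exact ⟨hp2, Or.inl (by linarith)⟩
      · refine of_halfPlane (a := 0) (b := -1) (t := -m) (by norm_num) ?_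
        filter_upwards [h, gt_of h0] with p hp hp2
        rw [hp]
        constructor
        · rintro ⟨_, h2 | h2⟩
          · linarith
          · linarith [h2.2]
        · intro h2
          exact ⟨hp2, Or.inl (by linarith)⟩
    · rcases lt_trichotomy (z 1) M with h2 | h2 | h2
      · refine of_halfPlane (a := s) (b := 0) (t := s * z 0) (by linarith) ?_
        filter_upwards [h, lt_of h2, gt_of h1, gt_of h0] with p hp hp1 hp2 hp3
        rw [hp]
        constructor
        · rintro ⟨_, h2 | h2⟩
          · linarith
          · linarith [h2.1]
        · intro h2
          exact ⟨hp3, Or.inr ⟨by linarith, hp1⟩⟩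
      · refine of_corner (s₁ := s) (s₂ := -1) (σ := 1) hs (by norm_num) (by norm_num) ?_
        filter_upwards [h, gt_of h1, gt_of h0] with p hp hp2 hp3
        rw [hp, one_mul, abs_sub_lt_add_iff, h2]
        constructor
        · rintro ⟨_, h2 | h2⟩
          · linarith
          · exact ⟨h2.1, by linarith [h2.2]⟩
        · rintro ⟨h3, h4⟩
          exact ⟨hp3, Or.inr ⟨h3, by linarith⟩⟩
      · refine absurd ?_ hne
        filter_upwards [h, gt_of h1, gt_of h2] with p hp hp1 hp2 hpΩ
        rcases hp.1 hpΩ with ⟨_, h3 | h3⟩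
        · linarith
        · linarith [h3.2]

end LipschitzCharts

/-! ### Finite unions of rectangles standing on a common line. -/

section StandingBoxes

variable {ι : Type*} [Fintype ι] {l r c : ι → ℝ}

lemma isClosed_rectangle (a b c d : ℝ) : IsClosed (rectangle a b c d) :=
  (isClosed_Icc.preimage (f := fun p : Plane => p 0) (by fun_prop)).inter
    (isClosed_Icc.preimage (f := fun p : Plane => p 1) (by fun_prop))

lemma openBox_subset_rectangle (a b c d : ℝ) : openBox a b c d ⊆ rectangle a b c d :=
  fun _ hx => ⟨Ioo_subset_Icc_self hx.1, Ioo_subset_Icc_self hx.2⟩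

/-- The interior of a union of closed rectangles standing on a common line, where no left end point
is a right end point, is the union of the open rectangles. -/
lemma interior_iUnion_rectangle (hlr : ∀ i j, l i ≠ r j) :
    interior (⋃ i, rectangle (l i) (r i) 0 (c i)) = ⋃ i, openBox (l i) (r i) 0 (c i) := by
  apply Subset.antisymm
  swap
  · exact interior_maximal (iUnion_mono fun i => openBox_subset_rectangle _ _ _ _)
      (isOpen_iUnion fun i => isOpen_openBox _ _ _ _)
  intro p hp
  -- Around an interior point, a small shift in any direction still lands in some rectangle.
  -- Shifting down gives `0 < p 1`; a diagonal upward shift makes the height strict together with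
  -- one horizontal inequality.
  have hev : ∀ v : Plane, ∀ᶠ t : ℝ in 𝓝[>] 0,
      ∃ i, p + t • v ∈ rectangle (l i) (r i) 0 (c i) := by
    intro v
    have hc : Tendsto (fun t : ℝ => p + t • v) (𝓝[>] 0) (𝓝 p) := by
      have : Tendsto (fun t : ℝ => p + t • v) (𝓝 0) (𝓝 (p + (0 : ℝ) • v)) :=
        Continuous.tendsto (by fun_prop) 0
      rw [zero_smul, add_zero] at this
      exact this.mono_left nhdsWithin_le_nhds
    filter_upwards [hc (mem_interior_iff_mem_nhds.1 hp)] with t ht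
    exact mem_iUnion.1 ht
  have hpos : ∀ᶠ t : ℝ in 𝓝[>] 0, 0 < t := self_mem_nhdsWithin
  have h0 : 0 < p 1 := by
    obtain ⟨t, ⟨i, hi⟩, ht⟩ := ((hev !₂[0, -1]).and hpos).exists
    have := hi.2.1
    simp at this
    linarith
  have hlt : ∀ {x y : ℝ}, x < y → ∀ᶠ t : ℝ in 𝓝[>] 0, x + t < y := by
    intro x y hxy
    filter_upwards [Ioo_mem_nhdsGT (sub_pos.2 hxy)] with t ht
    linarith [ht.2]
  by_cases hl : ∀ i, l i ≠ p 0
  · have h1 : ∀ᶠ t : ℝ in 𝓝[>] 0, ∀ i, l i ≤ p 0 + t → l i ≤ p 0 := by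
      refine eventually_all.2 fun i => ?_
      rcases le_or_gt (l i) (p 0) with h | h
      · exact Eventually.of_forall fun _ _ => h
      · filter_upwards [hlt h] with t ht ht'
        linarith
    obtain ⟨t, ⟨⟨i, hi⟩, ht⟩, h1⟩ := (((hev !₂[1, 1]).and hpos).and h1).exists
    obtain ⟨⟨i1, i2⟩, i3, i4⟩ := hi
    simp at i1 i2 i3 i4
    exact mem_iUnion.2 ⟨i, ⟨lt_of_le_of_ne (h1 i i1) (hl i), by linarith⟩, h0, by linarith⟩
  · push Not at hl
    obtain ⟨i₀, hi₀⟩ := hl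
    have hr : ∀ i, p 0 ≠ r i := fun i => hi₀ ▸ hlr i₀ i
    have h1 : ∀ᶠ t : ℝ in 𝓝[>] 0, ∀ i, p 0 - t ≤ r i → p 0 ≤ r i := by
      refine eventually_all.2 fun i => ?_
      rcases le_or_gt (p 0) (r i) with h | h
      · exact Eventually.of_forall fun _ _ => h
      · filter_upwards [hlt h] with t ht ht'
        linarith
    obtain ⟨t, ⟨⟨i, hi⟩, ht⟩, h1⟩ := (((hev !₂[-1, 1]).and hpos).and h1).exists
    obtain ⟨⟨i1, i2⟩, i3, i4⟩ := hi
    simp at i1 i2 i3 i4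
    exact mem_iUnion.2 ⟨i, ⟨by linarith, lt_of_le_of_ne (h1 i (by linarith)) (hr i)⟩, h0,
      by linarith⟩

/-- `m` is the largest height; inserting `0` covers the empty family, for which no `t > 0` lies
below `m`. -/
lemma exists_sup_of_finset {ι : Type*} (A : Finset ι) (c : ι → ℝ) :
    ∃ m : ℝ, 0 ≤ m ∧ ∀ t > 0, (t < m ↔ ∃ i ∈ A, t < c i) := by
  classical
  refine ⟨(insert 0 (A.image c)).max' (Finset.insert_nonempty _ _),
    Finset.le_max' _ _ (Finset.mem_insert_self _ _), fun t ht => ?_⟩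
  rw [← not_le, Finset.max'_le_iff]
  simp [ht.le]

/-- Near `z` the boxes extending across the abscissa `z 0` reach height `m` on both sides. As no
left end is a right end, boxes either only start or only end at `z 0`, so the height rises to `M` on
one side only and `HasLipschitzChart.of_step` applies. -/
lemma hasLipschitzChart_iUnion_openBox (hlr : ∀ i j, l i ≠ r j) {z : Plane}
    (hz : z ∈ frontier (⋃ i, openBox (l i) (r i) 0 (c i))) :
    HasLipschitzChart (⋃ i, openBox (l i) (r i) 0 (c i)) z := by
  classical
  set Ω := ⋃ i, openBox (l i) (r i) 0 (c i) with hΩ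
  have hopen : IsOpen Ω := isOpen_iUnion fun i => isOpen_openBox _ _ _ _
  rw [hopen.frontier_eq] at hz
  have c0 : ContinuousAt (fun p : Plane => p 0) z := by fun_prop
  have near : ∀ᶠ p in 𝓝 z, ∀ i,
      ((l i < z 0 → l i < p 0) ∧ (z 0 < l i → p 0 < l i)) ∧
      ((r i < z 0 → r i < p 0) ∧ (z 0 < r i → p 0 < r i)) := by
    refine eventually_all.2 fun i => ((?_ : ∀ᶠ p in 𝓝 z, _).and ?_).and
      ((?_ : ∀ᶠ p in 𝓝 z, _).and ?_)
    · by_cases h : l i < z 0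
      · filter_upwards [c0.eventually_const_lt h] with p hp _ using hp
      · exact Eventually.of_forall fun _ h' => absurd h' h
    · by_cases h : z 0 < l i
      · filter_upwards [c0.eventually_lt_const h] with p hp _ using hp
      · exact Eventually.of_forall fun _ h' => absurd h' h
    · by_cases h : r i < z 0
      · filter_upwards [c0.eventually_const_lt h] with p hp _ using hp
      · exact Eventually.of_forall fun _ h' => absurd h' h
    · by_cases h : z 0 < r i
      · filter_upwards [c0.eventually_lt_const h] with p hp _ using hp
      · exact Eventually.of_forall fun _ h' => absurd h' h
  obtain ⟨m, hm, hm'⟩ := exists_sup_of_finset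
    (Finset.univ.filter fun i => l i < z 0 ∧ z 0 < r i) c
  have mono : ∀ {M : ℝ} {B : Finset ι}, 0 ≤ M → (∀ t > 0, (t < M ↔ ∃ i ∈ B, t < c i)) →
      (∀ i, l i < z 0 ∧ z 0 < r i → i ∈ B) → m ≤ M := by
    intro M B hM hB hsub
    by_contra! hlt
    obtain ⟨i, hi, hi'⟩ := (hm' ((m + M) / 2) (by linarith)).1 (by linarith)
    have := (hB ((m + M) / 2) (by linarith)).2 ⟨i, hsub i (Finset.mem_filter.1 hi).2, hi'⟩
    linarith
  by_cases hl : ∀ i, l i ≠ z 0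
  · obtain ⟨M, hM, hM'⟩ := exists_sup_of_finset
      (Finset.univ.filter fun i => l i < z 0 ∧ z 0 ≤ r i) c
    refine HasLipschitzChart.of_step (s := -1) (m := m) (M := M) (by norm_num) hm
      (mono hM hM' fun i hi => by simp [hi.1, hi.2.le]) hz.1 hz.2 ?_
    filter_upwards [near] with p hp
    rw [hΩ, mem_iUnion]
    constructor
    · rintro ⟨i, ⟨i1, i2⟩, i3, i4⟩
      refine ⟨i3, ?_⟩
      have h1 : l i < z 0 := by
        rcases lt_trichotomy (l i) (z 0) with h | h | h
        · exact h
        · exact absurd h (hl i)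
        · exact absurd i1 ((hp i).1.2 h).not_gt
      rcases lt_trichotomy (r i) (z 0) with h | h | h
      · exact absurd i2 ((hp i).2.1 h).not_gt
      · right
        exact ⟨by linarith, (hM' _ i3).2 ⟨i, by simp [h1, h.ge], i4⟩⟩
      · left
        exact (hm' _ i3).2 ⟨i, by simp [h1, h], i4⟩
    · rintro ⟨h0, h | ⟨h1, h⟩⟩
      · obtain ⟨i, hi, hi'⟩ := (hm' _ h0).1 h
        simp only [Finset.mem_filter, Finset.mem_univ, true_and] at hi
        exact ⟨i, ⟨(hp i).1.1 hi.1, (hp i).2.2 hi.2⟩, h0, hi'⟩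
      · obtain ⟨i, hi, hi'⟩ := (hM' _ h0).1 h
        simp only [Finset.mem_filter, Finset.mem_univ, true_and] at hi
        exact ⟨i, ⟨(hp i).1.1 hi.1, by linarith⟩, h0, hi'⟩
  · push Not at hl
    obtain ⟨i₀, hi₀⟩ := hl
    have hr : ∀ i, z 0 ≠ r i := fun i => hi₀ ▸ hlr i₀ i
    obtain ⟨M, hM, hM'⟩ := exists_sup_of_finset
      (Finset.univ.filter fun i => l i ≤ z 0 ∧ z 0 < r i) c
    refine HasLipschitzChart.of_step (s := 1) (m := m) (M := M) (by norm_num) hm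
      (mono hM hM' fun i hi => by simp [hi.1.le, hi.2]) hz.1 hz.2 ?_
    filter_upwards [near] with p hp
    rw [hΩ, mem_iUnion]
    constructor
    · rintro ⟨i, ⟨i1, i2⟩, i3, i4⟩
      refine ⟨i3, ?_⟩
      have h1 : z 0 < r i := by
        rcases lt_trichotomy (r i) (z 0) with h | h | h
        · exact absurd i2 ((hp i).2.1 h).not_gt
        · exact absurd h.symm (hr i)
        · exact h
      rcases lt_trichotomy (l i) (z 0) with h | h | h
      · left
        exact (hm' _ i3).2 ⟨i, by simp [h1, h], i4⟩
      · right
        exact ⟨by linarith, (hM' _ i3).2 ⟨i, by simp [h1, h.le], i4⟩⟩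
      · exact absurd i1 ((hp i).1.2 h).not_gt
    · rintro ⟨h0, h | ⟨h1, h⟩⟩
      · obtain ⟨i, hi, hi'⟩ := (hm' _ h0).1 h
        simp only [Finset.mem_filter, Finset.mem_univ, true_and] at hi
        exact ⟨i, ⟨(hp i).1.1 hi.1, (hp i).2.2 hi.2⟩, h0, hi'⟩
      · obtain ⟨i, hi, hi'⟩ := (hM' _ h0).1 h
        simp only [Finset.mem_filter, Finset.mem_univ, true_and] at hi
        exact ⟨i, ⟨by linarith, (hp i).2.2 hi.2⟩, h0, hi'⟩

end StandingBoxes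

/-! ### Geometry of the domains: boundary regularity, connectedness, perimeter, diameter, area. -/

section RoomsAndPassages

/-- The height `½·2⁻³ʲ` of the `j`-th passage. -/
noncomputable def passageHeight (j : ℕ) : ℝ := 1 / 2 * (1 / 2) ^ (3 * j)

lemma blockOffset_eq (j : ℕ) : blockOffset j = 6 - 6 * (1 / 2) ^ j := by
  induction j with
  | zero => simp [blockOffset]
  | succ n ih =>
    have : blockOffset (n + 1) = blockOffset n + 3 * (1 / 2) ^ n := Finset.sum_range_succ _ _
    rw [this, ih, pow_succ]
    ring

lemma half_pow_pos (j : ℕ) : (0 : ℝ) < (1 / 2) ^ j := by positivity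

lemma half_pow_le_one (j : ℕ) : (1 / 2 : ℝ) ^ j ≤ 1 :=
  pow_le_one₀ (by norm_num) (by norm_num)

lemma passageHeight_pos (j : ℕ) : 0 < passageHeight j := by
  unfold passageHeight; positivity

lemma passageHeight_eq (j : ℕ) : passageHeight j = 1 / 2 * ((1 / 2) ^ j) ^ 3 := by
  rw [passageHeight, mul_comm 3 j, pow_mul]

lemma passageHeight_lt (j : ℕ) : passageHeight j < (1 / 2) ^ j := by
  rw [passageHeight_eq]
  have h0 := half_pow_pos j
  have h1 := half_pow_le_one j
  have h2 : ((1 / 2 : ℝ) ^ j) ^ 3 ≤ (1 / 2) ^ j := pow_le_of_le_one h0.le h1 (by norm_num)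
  linarith

lemma passageHeight_antitone : Antitone passageHeight := by
  intro i j hij
  unfold passageHeight
  have := pow_le_pow_of_le_one (show (0 : ℝ) ≤ 1 / 2 by norm_num) (by norm_num)
    (show 3 * i ≤ 3 * j by omega)
  linarith

lemma passageHeight_strictAnti : StrictAnti passageHeight := by
  intro i j hij
  unfold passageHeight
  have := pow_lt_pow_right_of_lt_one₀ (show (0 : ℝ) < 1 / 2 by norm_num) (by norm_num)
    (show 3 * i < 3 * j by omega)
  linarith

/-- Left ends of rectangles making up `Ω_k`: the passages, all prolonged to the left up to the
abscissa `0`, and the rooms. -/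
noncomputable def boxLeft (k : ℕ) : Fin k ⊕ Fin k → ℝ :=
  Sum.elim (fun _ => 0) (fun j => 6 - 5 * (1 / 2) ^ (j : ℕ))

/-- Right ends of the rectangles making up `Ω_k`. -/
noncomputable def boxRight (k : ℕ) : Fin k ⊕ Fin k → ℝ :=
  Sum.elim (fun j => 6 - 3 * (1 / 2) ^ (j : ℕ)) (fun j => 6 - 4 * (1 / 2) ^ (j : ℕ))

/-- Heights of the rectangles making up `Ω_k`. -/
noncomputable def boxHeight (k : ℕ) : Fin k ⊕ Fin k → ℝ :=
  Sum.elim (fun j => passageHeight j) (fun j => (1 / 2) ^ (j : ℕ))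

lemma boxLeft_lt_boxRight (k : ℕ) (i : Fin k ⊕ Fin k) : boxLeft k i < boxRight k i := by
  rcases i with j | j <;> simp only [boxLeft, boxRight, Sum.elim_inl, Sum.elim_inr]
  · linarith [half_pow_le_one j]
  · linarith [half_pow_pos j]

lemma boxHeight_pos (k : ℕ) (i : Fin k ⊕ Fin k) : 0 < boxHeight k i := by
  rcases i with j | j
  · exact passageHeight_pos j
  · exact half_pow_pos j

/-- For the rooms a coincidence would mean `5 · 2ʲ = m · 2ⁱ` with `m = 3` or `4`, impossible modulo
`5`. Passages prolonged to abscissa `0` avoid the coincidence at block ends, where `6 - 6 · 2⁻⁽ʲ⁺¹⁾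
= 6 - 3 · 2⁻ʲ`. -/
lemma boxLeft_ne_boxRight (k : ℕ) (i j : Fin k ⊕ Fin k) : boxLeft k i ≠ boxRight k j := by
  have key : ∀ (m : ℕ) (i j : ℕ), ¬ 5 ∣ m → 5 * (1 / 2 : ℝ) ^ i ≠ m * (1 / 2) ^ j := by
    intro m i j hm h
    have h1 : (5 * 2 ^ j : ℝ) = m * 2 ^ i := by
      rw [one_div, inv_pow, inv_pow] at h
      field_simp at h
      linarith
    have h2 : 5 * 2 ^ j = m * 2 ^ i := by exact_mod_cast h1
    have h3 : 5 ∣ m * 2 ^ i := ⟨_, h2.symm⟩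
    rcases (Nat.Prime.dvd_mul Nat.prime_five).1 h3 with h4 | h4
    · exact hm h4
    · have := Nat.Prime.dvd_of_dvd_pow Nat.prime_five h4
      omega
  rcases i with i | i <;> rcases j with j | j <;>
    simp only [boxLeft, boxRight, Sum.elim_inl, Sum.elim_inr]
  · linarith [half_pow_le_one j]
  · linarith [half_pow_le_one j]
  · intro h
    exact key 3 i j (by norm_num) (by push_cast; linarith)
  · intro h
    exact key 4 i j (by norm_num) (by push_cast; linarith)

lemma mem_translate_roomBlock {j : ℕ} {p : Plane} :
    p ∈ (fun p : Plane => !₂[blockOffset j, 0] + p) '' roomBlock j ↔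
      p ∈ rectangle (6 - 6 * (1 / 2) ^ j) (6 - 3 * (1 / 2) ^ j) 0 (passageHeight j) ∨
      p ∈ rectangle (6 - 5 * (1 / 2) ^ j) (6 - 4 * (1 / 2) ^ j) 0 ((1 / 2) ^ j) := by
  rw [image_add_left, mem_preimage, roomBlock, mem_union]
  simp only [rectangle, passageHeight, mem_ofPred_eq, mem_Icc, blockOffset_eq, PiLp.add_apply,
    PiLp.neg_apply]
  simp only [Matrix.cons_val_zero, Matrix.cons_val_one, neg_zero, zero_add]
  refine or_congr ?_ ?_ <;>
  · constructor <;> rintro ⟨⟨h1, h2⟩, h3⟩ <;> exact ⟨⟨by linarith, by linarith⟩, h3⟩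

lemma exists_mem_block {j : ℕ} {x : ℝ} (h0 : 0 ≤ x) (hx : x ≤ 6 - 3 * (1 / 2) ^ j) :
    ∃ i ≤ j, 6 - 6 * (1 / 2) ^ i ≤ x ∧ x ≤ 6 - 3 * (1 / 2) ^ i := by
  induction j with
  | zero => exact ⟨0, le_rfl, by simpa using h0, hx⟩
  | succ n ih =>
    by_cases h : x ≤ 6 - 3 * (1 / 2) ^ n
    · obtain ⟨i, hi, h⟩ := ih h
      exact ⟨i, by omega, h⟩
    · refine ⟨n + 1, le_rfl, ?_, hx⟩
      rw [pow_succ]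
      linarith

/-- Prolonging a passage to the left adds nothing, because the earlier passages are taller and
together cover the same abscissae. -/
lemma iUnion_translate_roomBlock (k : ℕ) :
    ⋃ j ∈ Finset.range k, (fun p : Plane => !₂[blockOffset j, 0] + p) '' roomBlock j =
      ⋃ i, rectangle (boxLeft k i) (boxRight k i) 0 (boxHeight k i) := by
  ext p
  simp only [mem_iUnion, exists_prop, Finset.mem_range, mem_translate_roomBlock]
  constructor
  · rintro ⟨j, hj, ⟨⟨h1, h2⟩, h3⟩ | h⟩
    · exact ⟨Sum.inl ⟨j, hj⟩, ⟨by simp only [boxLeft, Sum.elim_inl]; linarith [half_pow_le_one j],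
        h2⟩, h3⟩
    · exact ⟨Sum.inr ⟨j, hj⟩, h⟩
  · rintro ⟨j | j, h⟩
    · obtain ⟨⟨h1, h2⟩, h3, h4⟩ := h
      obtain ⟨i, hi, h5, h6⟩ := exists_mem_block h1 h2
      exact ⟨i, by omega, Or.inl ⟨⟨h5, h6⟩, h3, h4.trans (passageHeight_antitone hi)⟩⟩
    · exact ⟨j, j.2, Or.inr h⟩

lemma roomsAndPassages_eq (k : ℕ) :
    roomsAndPassages k = ⋃ i, openBox (boxLeft k i) (boxRight k i) 0 (boxHeight k i) := by
  rw [roomsAndPassages, iUnion_translate_roomBlock, interior_iUnion_rectangle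
    (boxLeft_ne_boxRight k)]

lemma isOpen_roomsAndPassages (k : ℕ) : IsOpen (roomsAndPassages k) := isOpen_interior

lemma roomsAndPassages_subset (k : ℕ) : roomsAndPassages k ⊆ openBox 0 6 0 1 := by
  rw [roomsAndPassages_eq]
  refine iUnion_subset fun i => ?_
  rcases i with j | j <;> rintro p ⟨⟨h1, h2⟩, h3, h4⟩ <;>
    simp only [boxLeft, boxRight, boxHeight, Sum.elim_inl, Sum.elim_inr] at h1 h2 h4
  · exact ⟨⟨h1, by linarith [half_pow_pos j]⟩, h3,
      by linarith [passageHeight_lt j, half_pow_le_one j]⟩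
  · exact ⟨⟨by linarith [half_pow_le_one j], by linarith [half_pow_pos j]⟩, h3,
      by linarith [half_pow_le_one j]⟩

lemma room_subset {k j : ℕ} (hj : j < k) :
    openBox (6 - 5 * (1 / 2) ^ j) (6 - 4 * (1 / 2) ^ j) 0 ((1 / 2) ^ j) ⊆ roomsAndPassages k := by
  rw [roomsAndPassages_eq]
  exact subset_iUnion (fun i => openBox (boxLeft k i) (boxRight k i) 0 (boxHeight k i))
    (Sum.inr ⟨j, hj⟩)

lemma passage_subset {k j : ℕ} (hj : j < k) :
    openBox 0 (6 - 3 * (1 / 2) ^ j) 0 (passageHeight j) ⊆ roomsAndPassages k := by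
  rw [roomsAndPassages_eq]
  exact subset_iUnion (fun i => openBox (boxLeft k i) (boxRight k i) 0 (boxHeight k i))
    (Sum.inl ⟨j, hj⟩)

lemma ediam_roomsAndPassages_le (k : ℕ) : Metric.ediam (roomsAndPassages k) ≤ 7 := by
  refine Metric.ediam_le fun p hp q hq => ?_
  obtain ⟨⟨p1, p2⟩, p3, p4⟩ := roomsAndPassages_subset k hp
  obtain ⟨⟨q1, q2⟩, q3, q4⟩ := roomsAndPassages_subset k hq
  rw [edist_dist, show (7 : ℝ≥0∞) = ENNReal.ofReal 7 by simp]
  refine ENNReal.ofReal_le_ofReal ?_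
  rw [EuclideanSpace.dist_eq, Fin.sum_univ_two, Real.dist_eq, Real.dist_eq, sq_abs, sq_abs]
  refine Real.sqrt_le_iff.2 ⟨by norm_num, ?_⟩
  have h1 : (p 0 - q 0) ^ 2 ≤ 6 ^ 2 := sq_le_sq' (by linarith) (by linarith)
  have h2 : (p 1 - q 1) ^ 2 ≤ 1 ^ 2 := sq_le_sq' (by linarith) (by linarith)
  linarith

lemma volume_roomsAndPassages_ne_top (k : ℕ) : volume (roomsAndPassages k) ≠ ⊤ := by
  refine ne_top_of_le_ne_top ?_ (measure_mono (roomsAndPassages_subset k))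
  rw [volume_openBox]
  exact ENNReal.mul_ne_top ENNReal.ofReal_ne_top ENNReal.ofReal_ne_top

lemma one_le_volume_roomsAndPassages {k : ℕ} (hk : 1 ≤ k) : 1 ≤ volume (roomsAndPassages k) := by
  refine le_trans (le_of_eq ?_) (measure_mono (room_subset (j := 0) hk))
  rw [volume_openBox]
  norm_num

lemma isConnected_roomsAndPassages {k : ℕ} (hk : 1 ≤ k) : IsConnected (roomsAndPassages k) := by
  have heq : roomsAndPassages k = ⋃ j : Fin k,
      (openBox 0 (6 - 3 * (1 / 2) ^ (j : ℕ)) 0 (passageHeight j) ∪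
        openBox (6 - 5 * (1 / 2) ^ (j : ℕ)) (6 - 4 * (1 / 2) ^ (j : ℕ)) 0 ((1 / 2) ^ (j : ℕ))) := by
    rw [roomsAndPassages_eq, iUnion_sum, iUnion_union_distrib]
    rfl
  refine ⟨⟨!₂[3 / 2, 1 / 2], room_subset (j := 0) hk ?_⟩, ?_⟩
  · refine ⟨⟨?_, ?_⟩, ?_, ?_⟩ <;> norm_num
  rw [heq]
  -- All prolonged passages share this point: its height `passageHeight k` is below that of every
  -- passage with index less than `k`.
  refine isPreconnected_iUnion ⟨!₂[1, passageHeight k], mem_iInter.2 fun j => Or.inl ?_⟩ fun j => ?_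
  · refine ⟨⟨?_, ?_⟩, ?_, ?_⟩
    · simp
    · simp only [Matrix.cons_val_zero]
      linarith [half_pow_le_one j]
    · simpa using passageHeight_pos k
    · simpa using passageHeight_strictAnti j.2
  · refine IsPreconnected.union !₂[6 - 9 / 2 * (1 / 2) ^ (j : ℕ), passageHeight j / 2] ?_ ?_
      (convex_openBox _ _ _ _).isPreconnected (convex_openBox _ _ _ _).isPreconnected
    · have h1 := half_pow_le_one j
      have h2 := half_pow_pos j
      have h3 := passageHeight_pos j
      refine ⟨⟨?_, ?_⟩, ?_, ?_⟩ <;> simp only [Matrix.cons_val_zero, Matrix.cons_val_one] <;>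
        linarith
    · have h1 := passageHeight_lt j
      have h2 := half_pow_pos j
      have h3 := passageHeight_pos j
      refine ⟨⟨?_, ?_⟩, ?_, ?_⟩ <;> simp only [Matrix.cons_val_zero, Matrix.cons_val_one] <;>
        linarith

lemma isBoundedLipschitzDomain_roomsAndPassages {k : ℕ} (hk : 1 ≤ k) :
    IsBoundedLipschitzDomain (roomsAndPassages k) where
  isOpen := isOpen_roomsAndPassages k
  isConnected := isConnected_roomsAndPassages hk
  isBounded := Metric.isBounded_iff_ediam_ne_top.2
    (ne_top_of_le_ne_top (by simp) (ediam_roomsAndPassages_le k))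
  lipschitz_boundary z hz := by
    rw [roomsAndPassages_eq] at hz ⊢
    exact hasLipschitzChart_iUnion_openBox (boxLeft_ne_boxRight k) hz

lemma hausdorffMeasure_horizontal_le (a b t : ℝ) :
    Measure.hausdorffMeasure 1 {p : Plane | p 0 ∈ Icc a b ∧ p 1 = t} ≤ ENNReal.ofReal (b - a) := by
  have hi : Isometry fun x : ℝ => (!₂[x, t] : Plane) := by
    refine Isometry.of_dist_eq fun x y => ?_
    rw [EuclideanSpace.dist_eq, Fin.sum_univ_two]
    simp [Real.sqrt_sq_eq_abs, Real.dist_eq]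
  have hsub : {p : Plane | p 0 ∈ Icc a b ∧ p 1 = t} ⊆ (fun x : ℝ => (!₂[x, t] : Plane)) '' Icc a b := by
    rintro p ⟨h1, rfl⟩
    refine ⟨p 0, h1, ?_⟩
    ext i
    fin_cases i <;> rfl
  refine (measure_mono hsub).trans ?_
  rw [hi.hausdorffMeasure_image (Or.inl zero_le_one), hausdorffMeasure_real, Real.volume_Icc]

lemma hausdorffMeasure_vertical_le (a b t : ℝ) :
    Measure.hausdorffMeasure 1 {p : Plane | p 0 = t ∧ p 1 ∈ Icc a b} ≤ ENNReal.ofReal (b - a) := by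
  have hi : Isometry fun x : ℝ => (!₂[t, x] : Plane) := by
    refine Isometry.of_dist_eq fun x y => ?_
    rw [EuclideanSpace.dist_eq, Fin.sum_univ_two]
    simp [Real.sqrt_sq_eq_abs, Real.dist_eq]
  have hsub : {p : Plane | p 0 = t ∧ p 1 ∈ Icc a b} ⊆ (fun x : ℝ => (!₂[t, x] : Plane)) '' Icc a b := by
    rintro p ⟨rfl, h1⟩
    refine ⟨p 1, h1, ?_⟩
    ext i
    fin_cases i <;> rfl
  refine (measure_mono hsub).trans ?_
  rw [hi.hausdorffMeasure_image (Or.inl zero_le_one), hausdorffMeasure_real, Real.volume_Icc]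

lemma hausdorffMeasure_rectangle_diff_openBox_le {a b c d : ℝ} (hab : a ≤ b) (hcd : c ≤ d) :
    Measure.hausdorffMeasure 1 (rectangle a b c d \ openBox a b c d) ≤
      ENNReal.ofReal (2 * (b - a) + 2 * (d - c)) := by
  have hsub : rectangle a b c d \ openBox a b c d ⊆
      ({p : Plane | p 0 ∈ Icc a b ∧ p 1 = c} ∪ {p : Plane | p 0 ∈ Icc a b ∧ p 1 = d}) ∪
      ({p : Plane | p 0 = a ∧ p 1 ∈ Icc c d} ∪ {p : Plane | p 0 = b ∧ p 1 ∈ Icc c d}) := by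
    rintro p ⟨⟨h1, h2⟩, h3⟩
    by_contra hcon
    simp only [mem_union, mem_ofPred_eq, h1, h2, true_and, and_true, not_or] at hcon
    obtain ⟨⟨n1, n2⟩, n3, n4⟩ := hcon
    exact h3 ⟨⟨lt_of_le_of_ne h1.1 (Ne.symm n3), lt_of_le_of_ne h1.2 n4⟩,
      lt_of_le_of_ne h2.1 (Ne.symm n1), lt_of_le_of_ne h2.2 n2⟩
  have e : ENNReal.ofReal (2 * (b - a) + 2 * (d - c)) =
      (ENNReal.ofReal (b - a) + ENNReal.ofReal (b - a)) +
        (ENNReal.ofReal (d - c) + ENNReal.ofReal (d - c)) := by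
    rw [← ENNReal.ofReal_add (by linarith) (by linarith),
      ← ENNReal.ofReal_add (by linarith) (by linarith),
      ← ENNReal.ofReal_add (by linarith) (by linarith)]
    congr 1
    ring
  rw [e]
  refine (measure_mono hsub).trans ((measure_union_le _ _).trans (add_le_add ?_ ?_)) <;>
    refine (measure_union_le _ _).trans (add_le_add ?_ ?_)
  · exact hausdorffMeasure_horizontal_le _ _ _
  · exact hausdorffMeasure_horizontal_le _ _ _
  · exact hausdorffMeasure_vertical_le _ _ _
  · exact hausdorffMeasure_vertical_le _ _ _

/-- A boundary point lies in some closed rectangle of the union but in none of the open ones. The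
`j`-th passage rectangle and room have perimeters adding up to `10 · 2⁻ʲ + 2 · passageHeight j ≤ 11
· 2⁻ʲ`, and the series sums to `22`. -/
lemma hausdorffMeasure_frontier_roomsAndPassages_le (k : ℕ) :
    Measure.hausdorffMeasure 1 (frontier (roomsAndPassages k)) ≤ 22 := by
  let P : ℕ → Set Plane := fun j =>
    rectangle (6 - 6 * (1 / 2) ^ j) (6 - 3 * (1 / 2) ^ j) 0 (passageHeight j) \
      openBox (6 - 6 * (1 / 2) ^ j) (6 - 3 * (1 / 2) ^ j) 0 (passageHeight j)
  let R : ℕ → Set Plane := fun j =>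
    rectangle (6 - 5 * (1 / 2) ^ j) (6 - 4 * (1 / 2) ^ j) 0 ((1 / 2) ^ j) \
      openBox (6 - 5 * (1 / 2) ^ j) (6 - 4 * (1 / 2) ^ j) 0 ((1 / 2) ^ j)
  have hsub : frontier (roomsAndPassages k) ⊆ ⋃ j ∈ Finset.range k, (P j ∪ R j) := by
    intro z hz
    rw [(isOpen_roomsAndPassages k).frontier_eq] at hz
    have hcl : IsClosed
        (⋃ i, rectangle (boxLeft k i) (boxRight k i) 0 (boxHeight k i)) :=
      isClosed_iUnion_of_finite fun i => isClosed_rectangle _ _ _ _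
    have h1 : z ∈ ⋃ j ∈ Finset.range k,
        (fun p : Plane => !₂[blockOffset j, 0] + p) '' roomBlock j := by
      rw [iUnion_translate_roomBlock]
      refine closure_minimal ?_ hcl hz.1
      rw [← iUnion_translate_roomBlock]
      exact interior_subset
    simp only [mem_iUnion, exists_prop, Finset.mem_range, mem_translate_roomBlock] at h1 ⊢
    obtain ⟨j, hj, h | h⟩ := h1
    · refine ⟨j, hj, Or.inl ⟨h, fun h' => hz.2 (passage_subset hj ⟨⟨?_, h'.1.2⟩, h'.2⟩)⟩⟩
      linarith [h'.1.1, half_pow_le_one j]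
    · exact ⟨j, hj, Or.inr ⟨h, fun h' => hz.2 (room_subset hj h')⟩⟩
  have hj : ∀ j, Measure.hausdorffMeasure 1 (P j ∪ R j) ≤ ENNReal.ofReal (11 * (1 / 2) ^ j) := by
    intro j
    have h0 := half_pow_pos j
    have hp := passageHeight_pos j
    have hp' := passageHeight_lt j
    have e1 := hausdorffMeasure_rectangle_diff_openBox_le
      (a := 6 - 6 * (1 / 2) ^ j) (b := 6 - 3 * (1 / 2) ^ j) (c := 0) (d := passageHeight j)
      (by linarith) hp.le
    have e2 := hausdorffMeasure_rectangle_diff_openBox_le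
      (a := 6 - 5 * (1 / 2) ^ j) (b := 6 - 4 * (1 / 2) ^ j) (c := 0) (d := (1 / 2) ^ j)
      (by linarith) h0.le
    refine (measure_union_le _ _).trans ((add_le_add e1 e2).trans ?_)
    rw [← ENNReal.ofReal_add (by linarith) (by linarith)]
    refine ENNReal.ofReal_le_ofReal ?_
    have hq : passageHeight j ≤ 1 / 2 * (1 / 2) ^ j := by
      rw [passageHeight_eq]
      have h2 : ((1 / 2 : ℝ) ^ j) ^ 3 ≤ (1 / 2) ^ j :=
        pow_le_of_le_one h0.le (half_pow_le_one j) (by norm_num)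
      linarith
    linarith
  calc Measure.hausdorffMeasure 1 (frontier (roomsAndPassages k))
      ≤ ∑ j ∈ Finset.range k, ENNReal.ofReal (11 * (1 / 2) ^ j) :=
        (measure_mono hsub).trans ((measure_biUnion_finset_le _ _).trans
          (Finset.sum_le_sum fun j _ => hj j))
    -- The geometric sum is already evaluated in `blockOffset`, whose terms are `3 · 2⁻ʲ`.
    _ = ENNReal.ofReal (11 / 3 * blockOffset k) := by
        rw [← ENNReal.ofReal_sum_of_nonneg (fun j _ => by positivity), blockOffset, Finset.mul_sum]
        congr 1
        refine Finset.sum_congr rfl fun j _ => ?_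
        ring
    _ ≤ 22 := by
        rw [show (22 : ℝ≥0∞) = ENNReal.ofReal 22 by simp, blockOffset_eq]
        exact ENNReal.ofReal_le_ofReal (by linarith [half_pow_pos k])

lemma isoperimetricRatio_roomsAndPassages_le {k : ℕ} (hk : 1 ≤ k) :
    isoperimetricRatio (roomsAndPassages k) ≤ 484 := by
  refine ENNReal.div_le_of_le_mul ?_
  calc _ ≤ (22 : ℝ≥0∞) ^ 2 := pow_le_pow_left' (hausdorffMeasure_frontier_roomsAndPassages_le k) 2
    _ = 484 * 1 := by norm_num
    _ ≤ _ := by gcongr; exact one_le_volume_roomsAndPassages hk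

lemma diameterRatio_roomsAndPassages_le {k : ℕ} (hk : 1 ≤ k) :
    diameterRatio (roomsAndPassages k) ≤ 484 := by
  refine ENNReal.div_le_of_le_mul ?_
  calc _ ≤ (7 : ℝ≥0∞) ^ 2 := pow_le_pow_left' (ediam_roomsAndPassages_le k) 2
    _ ≤ 484 * 1 := by norm_num
    _ ≤ _ := by gcongr; exact one_le_volume_roomsAndPassages hk

lemma compactlyEmbedded_roomsAndPassages (k : ℕ) :
    CompactlyEmbedded (sobolevH1 (roomsAndPassages k)) := by
  refine compactlyEmbedded_sobolevH1 (a := boxLeft k) (b := boxRight k) (c := fun _ => 0)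
    (d := boxHeight k) (boxLeft_lt_boxRight k) (boxHeight_pos k) (fun i => ?_) ?_
  · rw [roomsAndPassages_eq]
    exact subset_iUnion (fun i => openBox (boxLeft k i) (boxRight k i) 0 (boxHeight k i)) i
  · exact (roomsAndPassages_eq k).subset.eventuallyLE

end RoomsAndPassages

/-! ### The cut-off functions of the rooms and their Rayleigh quotients. -/

section NeumannTestFunctions

/-- A cut-off function in the abscissa: `1` above the `j`-th room, decaying linearly to `0` along the
`j`-th passages. -/
noncomputable def roomCutoff (j : ℕ) (p : Plane) : ℝ :=
  max 0 (min 1 (min (2 ^ j * (p 0 - (6 - 6 * (1 / 2) ^ j))) (2 ^ j * (6 - 3 * (1 / 2) ^ j - p 0))))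

lemma two_pow_mul_half_pow (j : ℕ) : (2 : ℝ) ^ j * (1 / 2) ^ j = 1 := by
  rw [← mul_pow]; norm_num

lemma lipschitzWith_roomCutoff (j : ℕ) : LipschitzWith (2 ^ j) (roomCutoff j) := by
  have h1 : LipschitzWith (2 ^ j) fun p : Plane => 2 ^ j * (p 0 - (6 - 6 * (1 / 2 : ℝ) ^ j)) := by
    refine LipschitzWith.of_dist_le_mul fun p q => ?_
    rw [Real.dist_eq, ← mul_sub, sub_sub_sub_cancel_right, abs_mul, abs_of_pos (by positivity),
      dist_eq_norm]
    push_cast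
    gcongr
    exact PiLp.norm_apply_le (p - q) 0
  have h2 : LipschitzWith (2 ^ j) fun p : Plane => 2 ^ j * (6 - 3 * (1 / 2 : ℝ) ^ j - p 0) := by
    refine LipschitzWith.of_dist_le_mul fun p q => ?_
    rw [Real.dist_eq, ← mul_sub, sub_sub_sub_cancel_left, abs_mul, abs_of_pos (by positivity),
      dist_eq_norm, norm_sub_rev]
    push_cast
    gcongr
    exact PiLp.norm_apply_le (q - p) 0
  have h3 := ((h1.min h2).const_min 1).const_max 0
  rw [max_self] at h3
  exact h3

lemma roomCutoff_nonneg (j : ℕ) (p : Plane) : 0 ≤ roomCutoff j p := le_max_left _ _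

lemma roomCutoff_le_one (j : ℕ) (p : Plane) : roomCutoff j p ≤ 1 :=
  max_le zero_le_one (min_le_left _ _)

lemma roomCutoff_eq_zero {j : ℕ} {p : Plane}
    (hp : p 0 ≤ 6 - 6 * (1 / 2) ^ j ∨ 6 - 3 * (1 / 2) ^ j ≤ p 0) : roomCutoff j p = 0 := by
  have h2 : (0 : ℝ) ≤ 2 ^ j := by positivity
  refine max_eq_left ((min_le_right _ _).trans ?_)
  rcases hp with hp | hp
  · exact (min_le_left _ _).trans (mul_nonpos_of_nonneg_of_nonpos h2 (by linarith))
  · exact (min_le_right _ _).trans (mul_nonpos_of_nonneg_of_nonpos h2 (by linarith))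

lemma roomCutoff_eq_one {j : ℕ} {p : Plane}
    (hp : p 0 ∈ Icc (6 - 5 * (1 / 2 : ℝ) ^ j) (6 - 4 * (1 / 2) ^ j)) : roomCutoff j p = 1 := by
  have h2 : (0 : ℝ) < 2 ^ j := by positivity
  have h := two_pow_mul_half_pow j
  have h3 : 1 ≤ min (2 ^ j * (p 0 - (6 - 6 * (1 / 2 : ℝ) ^ j)))
      (2 ^ j * (6 - 3 * (1 / 2) ^ j - p 0)) := by
    refine h.symm.trans_le (le_min ?_ ?_)
    · exact mul_le_mul_of_nonneg_left (by linarith [hp.1]) h2.le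
    · exact mul_le_mul_of_nonneg_left (by linarith [hp.2]) h2.le
  rw [roomCutoff, min_eq_left h3]
  exact max_eq_right zero_le_one

lemma gradient_roomCutoff_eq_zero {j : ℕ} {p : Plane} (hp : p 0 < 6 - 6 * (1 / 2) ^ j ∨
    p 0 ∈ Ioo (6 - 5 * (1 / 2 : ℝ) ^ j) (6 - 4 * (1 / 2) ^ j) ∨ 6 - 3 * (1 / 2) ^ j < p 0) :
    gradient (roomCutoff j) p = 0 := by
  have c0 : ContinuousAt (fun p : Plane => p 0) p := by fun_prop
  rcases hp with hp | hp | hp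
  · have : roomCutoff j =ᶠ[𝓝 p] fun _ => 0 := by
      filter_upwards [c0.eventually_lt_const hp] with q hq
      exact roomCutoff_eq_zero (Or.inl hq.le)
    rw [this.gradient_eq, gradient_fun_const]
  · have : roomCutoff j =ᶠ[𝓝 p] fun _ => 1 := by
      filter_upwards [c0.eventually_mem (isOpen_Ioo.mem_nhds hp)] with q hq
      exact roomCutoff_eq_one (Ioo_subset_Icc_self hq)
    rw [this.gradient_eq, gradient_fun_const]
  · have : roomCutoff j =ᶠ[𝓝 p] fun _ => 0 := by
      filter_upwards [c0.eventually_const_lt hp] with q hq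
      exact roomCutoff_eq_zero (Or.inr hq.le)
    rw [this.gradient_eq, gradient_fun_const]

lemma LipschitzWith.norm_gradient_le {f : Plane → ℝ} {K : ℝ≥0} (hf : LipschitzWith K f)
    (p : Plane) : ‖gradient f p‖ ≤ K := by
  rw [gradient, LinearIsometryEquiv.norm_map]
  exact norm_fderiv_le_of_lipschitz ℝ hf

/-- A bounded Lipschitz function on a set of finite measure, together with its gradient. -/
lemma LipschitzWith.exists_pair {f : Plane → ℝ} {K : ℝ≥0} (hf : LipschitzWith K f) {C : ℝ}
    (hC : ∀ p, ‖f p‖ ≤ C) {Ω : Set Plane} (hΩ : volume Ω ≠ ⊤) :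
    ∃ w : GradientPairs Ω, w.fst =ᵐ[volume.restrict Ω] f ∧
      w.snd =ᵐ[volume.restrict Ω] gradient f := by
  have : IsFiniteMeasure (volume.restrict Ω) := ⟨by simpa using hΩ.lt_top⟩
  have h1 : MemLp f 2 (volume.restrict Ω) :=
    MemLp.of_bound hf.continuous.aestronglyMeasurable C (Eventually.of_forall hC)
  have hm : Measurable (gradient f) :=
    (InnerProductSpace.toDual ℝ Plane).symm.continuous.measurable.comp (measurable_fderiv ℝ f)
  have h2 : MemLp (gradient f) 2 (volume.restrict Ω) :=
    MemLp.of_bound hm.aestronglyMeasurable K (Eventually.of_forall hf.norm_gradient_le)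
  exact ⟨WithLp.toLp 2 (h1.toLp f, h2.toLp (gradient f)), h1.coeFn_toLp, h2.coeFn_toLp⟩

lemma exists_roomPair (k j : ℕ) : ∃ w : GradientPairs (roomsAndPassages k),
    w.fst =ᵐ[volume.restrict (roomsAndPassages k)] roomCutoff j ∧
      w.snd =ᵐ[volume.restrict (roomsAndPassages k)] gradient (roomCutoff j) :=
  (lipschitzWith_roomCutoff j).exists_pair (C := 1) (fun p => by
    rw [Real.norm_of_nonneg (roomCutoff_nonneg j p)]
    exact roomCutoff_le_one j p) (volume_roomsAndPassages_ne_top k)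

/-- The pair `(f, ∇f)` for the cut-off function `f` of the `j`-th room. -/
noncomputable def roomPair (k j : ℕ) : GradientPairs (roomsAndPassages k) :=
  (exists_roomPair k j).choose

lemma roomPair_fst (k j : ℕ) :
    (roomPair k j).fst =ᵐ[volume.restrict (roomsAndPassages k)] roomCutoff j :=
  (exists_roomPair k j).choose_spec.1

lemma roomPair_snd (k j : ℕ) :
    (roomPair k j).snd =ᵐ[volume.restrict (roomsAndPassages k)] gradient (roomCutoff j) :=
  (exists_roomPair k j).choose_spec.2

lemma roomPair_mem (k j : ℕ) : roomPair k j ∈ sobolevH1 (roomsAndPassages k) :=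
  mem_sobolevH1_of_lipschitz (lipschitzWith_roomCutoff j) (roomPair_fst k j) (roomPair_snd k j)

lemma block_end_le {i j : ℕ} (h : i < j) :
    (6 : ℝ) - 3 * (1 / 2) ^ i ≤ 6 - 6 * (1 / 2) ^ j := by
  have := pow_le_pow_of_le_one (show (0 : ℝ) ≤ 1 / 2 by norm_num) (by norm_num)
    (show i + 1 ≤ j from h)
  rw [pow_succ] at this
  linarith

lemma inner_roomPair_fst {k i j : ℕ} (hij : i ≠ j) :
    inner ℝ (roomPair k i).fst (roomPair k j).fst = 0 := by
  wlog h : i < j generalizing i j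
  · rw [real_inner_comm]
    exact this hij.symm (by omega)
  rw [L2.inner_def]
  refine integral_eq_zero_of_ae ?_
  filter_upwards [roomPair_fst k i, roomPair_fst k j] with p h1 h2
  rw [h1, h2]
  rcases le_total (p 0) (6 - 6 * (1 / 2) ^ j) with h3 | h3
  · simp [roomCutoff_eq_zero (Or.inl h3)]
  · simp [roomCutoff_eq_zero (Or.inr ((block_end_le h).trans h3))]

lemma ae_coord_ne (k : ℕ) (i : Fin 2) (t : ℝ) :
    ∀ᵐ p : Plane ∂(volume.restrict (roomsAndPassages k)), p i ≠ t :=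
  ae_restrict_of_ae (by simpa [ae_iff] using volume_setOf_coord_eq i t)

/-- The blocks meet at most in a vertical line, which is null; off it one of the two gradients
vanishes. -/
lemma inner_roomPair_snd {k i j : ℕ} (hij : i ≠ j) :
    inner ℝ (roomPair k i).snd (roomPair k j).snd = 0 := by
  wlog h : i < j generalizing i j
  · rw [real_inner_comm]
    exact this hij.symm (by omega)
  rw [L2.inner_def]
  refine integral_eq_zero_of_ae ?_
  filter_upwards [roomPair_snd k i, roomPair_snd k j,
    ae_coord_ne k 0 (6 - 6 * (1 / 2) ^ j)] with p h1 h2 h0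
  rw [h1, h2]
  rcases lt_or_gt_of_ne h0 with h3 | h3
  · simp [gradient_roomCutoff_eq_zero (Or.inl h3)]
  · simp [gradient_roomCutoff_eq_zero (Or.inr (Or.inr ((block_end_le h).trans_lt h3)))]

lemma sq_le_norm_roomPair_fst_sq {k j : ℕ} (hj : j < k) :
    ((1 / 2) ^ j) ^ 2 ≤ ‖(roomPair k j).fst‖ ^ 2 := by
  rw [norm_sq_eq_integral (roomPair_fst k j)]
  set R := openBox (6 - 5 * (1 / 2) ^ j) (6 - 4 * (1 / 2) ^ j) 0 ((1 / 2) ^ j) with hR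
  have hRm : MeasurableSet R := (isOpen_openBox _ _ _ _).measurableSet
  have : IsFiniteMeasure (volume.restrict (roomsAndPassages k)) :=
    ⟨by simpa using (volume_roomsAndPassages_ne_top k).lt_top⟩
  have hvol : (volume.restrict (roomsAndPassages k)).real R = ((1 / 2) ^ j) ^ 2 := by
    rw [Measure.real, Measure.restrict_apply hRm, inter_eq_left.2 (room_subset hj),
      volume_openBox, ENNReal.toReal_mul, ENNReal.toReal_ofReal, ENNReal.toReal_ofReal]
    · ring
    · linarith [half_pow_pos j]
    · linarith [half_pow_pos j]
  rw [← hvol, ← integral_indicator_one hRm]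
  refine integral_mono ((integrable_const (1 : ℝ)).indicator hRm) ?_ fun p => ?_
  · refine Integrable.of_bound (C := 1)
      ((lipschitzWith_roomCutoff j).continuous.norm.pow 2).aestronglyMeasurable
      (Eventually.of_forall fun p => ?_)
    rw [norm_pow, norm_norm, Real.norm_of_nonneg (roomCutoff_nonneg j p)]
    exact pow_le_one₀ (roomCutoff_nonneg j p) (roomCutoff_le_one j p)
  · by_cases hp : p ∈ R
    · simp [indicator_of_mem hp, roomCutoff_eq_one (Ioo_subset_Icc_self hp.1)]
    · rw [indicator_of_notMem hp]
      positivity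

/-- Over the two necks of block `j` there is no room, and a passage reaching that far has index at
least `j`, hence at most the height of passage `j`. -/
lemma lt_passageHeight {k j : ℕ} {p : Plane} (hp : p ∈ roomsAndPassages k)
    (h : p 0 ∈ Ioo (6 - 6 * (1 / 2 : ℝ) ^ j) (6 - 5 * (1 / 2) ^ j) ∨
      p 0 ∈ Ioo (6 - 4 * (1 / 2 : ℝ) ^ j) (6 - 3 * (1 / 2) ^ j)) : p 1 < passageHeight j := by
  have h0 : 6 - 6 * (1 / 2 : ℝ) ^ j < p 0 ∧ p 0 < 6 - 3 * (1 / 2) ^ j := by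
    have := half_pow_pos j
    rcases h with h | h <;> constructor <;> linarith [h.1, h.2]
  rw [roomsAndPassages_eq, mem_iUnion] at hp
  obtain ⟨i | i, ⟨h1, h2⟩, h3, h4⟩ := hp <;>
    simp only [boxLeft, boxRight, boxHeight, Sum.elim_inl, Sum.elim_inr] at h1 h2 h4
  · refine h4.trans_le (passageHeight_antitone ?_)
    by_contra! hij
    linarith [block_end_le hij]
  · rcases lt_trichotomy (i : ℕ) j with hij | hij | hij
    · linarith [block_end_le hij, half_pow_pos i]
    · subst hij
      rcases h with h | h <;> linarith [h.1, h.2]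
    · linarith [block_end_le hij, half_pow_pos i]

/-- The gradient is at most `2^j` and lives on two necks of length `2⁻ʲ` and height `½ · 2⁻³ʲ`. The
exponent `3` in the height is what makes the product the area `2⁻²ʲ` of the room. -/
lemma norm_roomPair_snd_sq_le (k j : ℕ) :
    ‖(roomPair k j).snd‖ ^ 2 ≤ ((1 / 2) ^ j) ^ 2 := by
  rw [norm_sq_eq_integral (roomPair_snd k j)]
  set S := openBox (6 - 6 * (1 / 2) ^ j) (6 - 5 * (1 / 2) ^ j) 0 (passageHeight j) ∪
    openBox (6 - 4 * (1 / 2) ^ j) (6 - 3 * (1 / 2) ^ j) 0 (passageHeight j) with hS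
  have hSm : MeasurableSet S :=
    ((isOpen_openBox _ _ _ _).union (isOpen_openBox _ _ _ _)).measurableSet
  have : IsFiniteMeasure (volume.restrict (roomsAndPassages k)) :=
    ⟨by simpa using (volume_roomsAndPassages_ne_top k).lt_top⟩
  have h2 := two_pow_mul_half_pow j
  have hpos := half_pow_pos j
  have hpp := passageHeight_pos j
  have hvol : (volume.restrict (roomsAndPassages k)).real S ≤
      2 * ((1 / 2) ^ j * passageHeight j) := by
    have hb : volume S ≤ ENNReal.ofReal (2 * ((1 / 2) ^ j * passageHeight j)) := by
      refine (measure_union_le _ _).trans (le_of_eq ?_)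
      rw [volume_openBox, volume_openBox, ← ENNReal.ofReal_mul (by linarith),
        ← ENNReal.ofReal_mul (by linarith), ← ENNReal.ofReal_add]
      · congr 1; ring
      · exact mul_nonneg (by linarith) (by linarith)
      · exact mul_nonneg (by linarith) (by linarith)
    exact ENNReal.toReal_le_of_le_ofReal (by positivity)
      ((Measure.restrict_apply_le _ _).trans hb)
  calc ∫ p in roomsAndPassages k, ‖gradient (roomCutoff j) p‖ ^ 2
      ≤ ∫ p in roomsAndPassages k, S.indicator (fun _ => ((2 : ℝ) ^ j) ^ 2) p := by
        refine integral_mono_of_nonneg (Eventually.of_forall fun p => by positivity)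
          ((integrable_const _).indicator hSm) ?_
        filter_upwards [ae_coord_ne k 0 (6 - 6 * (1 / 2) ^ j), ae_coord_ne k 0 (6 - 5 * (1 / 2) ^ j),
          ae_coord_ne k 0 (6 - 4 * (1 / 2) ^ j), ae_coord_ne k 0 (6 - 3 * (1 / 2) ^ j),
          ae_restrict_mem (isOpen_roomsAndPassages k).measurableSet] with p n1 n2 n3 n4 hp
        by_cases hpS : p ∈ S
        · rw [indicator_of_mem hpS]
          have := (lipschitzWith_roomCutoff j).norm_gradient_le p
          push_cast at this
          gcongr
        · rw [indicator_of_notMem hpS, gradient_roomCutoff_eq_zero]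
          · simp
          · have p0 := (roomsAndPassages_subset k hp).2.1
            by_contra! hcon
            obtain ⟨c1, c2, c3⟩ := hcon
            have c1' := lt_of_le_of_ne c1 n1.symm
            have c3' := lt_of_le_of_ne c3 n4
            rcases lt_or_gt_of_ne n2 with c | c
            · exact hpS (Or.inl ⟨⟨c1', c⟩, p0, lt_passageHeight hp (Or.inl ⟨c1', c⟩)⟩)
            · have c' : 6 - 4 * (1 / 2) ^ j < p 0 := by
                refine lt_of_le_of_ne ?_ n3.symm
                by_contra! c'
                exact c2 ⟨c, c'⟩
              exact hpS (Or.inr ⟨⟨c', c3'⟩, p0, lt_passageHeight hp (Or.inr ⟨c', c3'⟩)⟩)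
    _ = (volume.restrict (roomsAndPassages k)).real S * ((2 : ℝ) ^ j) ^ 2 := by
        rw [integral_indicator_const _ hSm, smul_eq_mul]
    _ ≤ 2 * ((1 / 2) ^ j * passageHeight j) * ((2 : ℝ) ^ j) ^ 2 := by gcongr
    _ = ((2 : ℝ) ^ j * (1 / 2) ^ j) ^ 2 * ((1 / 2) ^ j) ^ 2 := by rw [passageHeight_eq]; ring
    _ = _ := by rw [h2]; ring

lemma linearIndependent_roomPair (k : ℕ) : LinearIndependent ℝ fun j : Fin k => roomPair k j := by
  refine linearIndependent_of_ne_zero_of_inner_eq_zero (fun j h => ?_) fun i j hij => ?_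
  · have := sq_le_norm_roomPair_fst_sq j.2
    rw [h] at this
    have h0 : ‖(0 : GradientPairs (roomsAndPassages k)).fst‖ = 0 := norm_zero
    rw [h0] at this
    have h1 : 0 < ((1 / 2 : ℝ) ^ (j : ℕ)) ^ 2 := by positivity
    linarith
  · have hij' : (i : ℕ) ≠ j := fun h => hij (Fin.ext h)
    change inner ℝ (roomPair k i).fst (roomPair k j).fst +
      inner ℝ (roomPair k i).snd (roomPair k j).snd = 0
    rw [inner_roomPair_fst hij', inner_roomPair_snd hij', add_zero]

/-- Orthogonality of the functions and of their gradients makes both forms diagonal, so the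
inequality follows from that for each single room. -/
lemma norm_snd_sq_le_of_mem_span_roomPair {k : ℕ} {u : GradientPairs (roomsAndPassages k)}
    (hu : u ∈ Submodule.span ℝ (range fun j : Fin k => roomPair k j)) :
    ‖u.snd‖ ^ 2 ≤ ‖u.fst‖ ^ 2 := by
  obtain ⟨a, rfl⟩ := (Submodule.mem_span_range_iff_exists_fun ℝ).1 hu
  have h1 : (∑ j, a j • roomPair k j).fst = ∑ j, a j • (roomPair k j).fst := by
    rw [← WithLp.fstL_apply (𝕜 := ℝ)]
    simp
  have h2 : (∑ j, a j • roomPair k j).snd = ∑ j, a j • (roomPair k j).snd := by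
    rw [← WithLp.sndL_apply (𝕜 := ℝ)]
    simp
  have e1 : ‖(∑ j, a j • roomPair k j).fst‖ ^ 2 = ∑ j, a j ^ 2 * ‖(roomPair k j).fst‖ ^ 2 := by
    rw [← real_inner_self_eq_norm_sq, h1, sum_inner]
    refine Finset.sum_congr rfl fun i _ => ?_
    rw [inner_sum, Finset.sum_eq_single i, real_inner_smul_left, real_inner_smul_right,
      real_inner_self_eq_norm_sq]
    · ring
    · intro j _ hj
      rw [real_inner_smul_left, real_inner_smul_right,
        inner_roomPair_fst (fun h => hj (Fin.ext h.symm)), mul_zero, mul_zero]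
    · simp
  have e2 : ‖(∑ j, a j • roomPair k j).snd‖ ^ 2 = ∑ j, a j ^ 2 * ‖(roomPair k j).snd‖ ^ 2 := by
    rw [← real_inner_self_eq_norm_sq, h2, sum_inner]
    refine Finset.sum_congr rfl fun i _ => ?_
    rw [inner_sum, Finset.sum_eq_single i, real_inner_smul_left, real_inner_smul_right,
      real_inner_self_eq_norm_sq]
    · ring
    · intro j _ hj
      rw [real_inner_smul_left, real_inner_smul_right,
        inner_roomPair_snd (fun h => hj (Fin.ext h.symm)), mul_zero, mul_zero]
    · simp
  rw [e1, e2]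
  refine Finset.sum_le_sum fun j _ => mul_le_mul_of_nonneg_left ?_ (sq_nonneg _)
  exact (norm_roomPair_snd_sq_le k j).trans (sq_le_norm_roomPair_fst_sq j.2)

end NeumannTestFunctions

/-! ### Existence and lower bound of the first Dirichlet eigenvalue. -/

section FirstDirichletEigenvalue

variable {Ω : Set Plane}

lemma exists_mem_sobolevH10_fst_ne_zero (hΩ : IsOpen Ω) (hne : Ω.Nonempty) :
    ∃ w ∈ sobolevH10 Ω, w.fst ≠ 0 := by
  obtain ⟨x, hx⟩ := hne
  obtain ⟨φ, hφs, hφc, hφ, -, hφx⟩ :=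
    exists_contDiff_tsupport_subset (n := ⊤) (hΩ.mem_nhds hx)
  have ht : IsTestFunction Ω φ := ⟨hφ, hφc, hφs⟩
  refine ⟨ht.pair, ht.pair_mem, fun h0 => ?_⟩
  have h1 : φ =ᵐ[volume.restrict Ω] 0 := by
    have h2 : ht.pair.fst =ᵐ[volume.restrict Ω] φ := ht.memLp.coeFn_toLp
    rw [h0] at h2
    exact h2.symm.trans (Lp.coeFn_zero ..)
  have h3 := Measure.eqOn_open_of_ae_eq h1 hΩ hφ.continuous.continuousOn continuousOn_const hx
  rw [hφx] at h3
  exact one_ne_zero h3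

/-- If `H¹(Ω)` embeds compactly into `L²(Ω)`, there is a Dirichlet eigenvalue. -/
lemma dirichletEigenvalues_nonempty (hΩ : IsOpen Ω) (hne : Ω.Nonempty)
    (hc : CompactlyEmbedded (sobolevH1 Ω)) : (dirichletEigenvalues Ω).Nonempty := by
  by_contra hemp
  have hbot : ∀ μ, weakEigenspace (sobolevH10 Ω) μ = ⊥ := by
    intro μ
    by_contra h
    exact hemp ⟨μ, h⟩
  obtain ⟨w, hw, hw0⟩ := exists_mem_sobolevH10_fst_ne_zero hΩ hne
  have hpos : 0 < ‖w.fst‖ ^ 2 := by positivity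
  -- Without eigenfunctions orthogonality to them is vacuous, so the variational bound would hold
  -- with a constant exceeding the Rayleigh quotient of `w`.
  have key := mul_norm_fst_sq_le_of_orthogonal (isClosed_sobolevH10 Ω)
    (hc.mono (sobolevH10_le_sobolevH1 Ω)) (c := ‖w.snd‖ ^ 2 / ‖w.fst‖ ^ 2 + 1) (by positivity) hw
    (E := weakEigenspace (sobolevH10 Ω)) (fun _ _ => Iff.rfl) (by
      intro μ _ z hz
      rw [hbot μ, Submodule.mem_bot] at hz
      rw [hz, inner_zero_left])
  rw [add_mul, div_mul_cancel₀ _ hpos.ne'] at key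
  linarith

/-- An eigenfunction tested with itself has Rayleigh quotient equal to its eigenvalue, which the
strip inequality bounds below. Existence of an eigenvalue is essential, as the infimum of the empty
set of reals is `0`. -/
lemma le_firstDirichletEigenvalue (hΩ : IsOpen Ω) (hne : Ω.Nonempty)
    (hs : ∀ x ∈ Ω, x 1 ∈ Icc (0 : ℝ) 1) (hc : CompactlyEmbedded (sobolevH1 Ω)) :
    7 / 5 ≤ firstDirichletEigenvalue Ω := by
  refine le_csInf (dirichletEigenvalues_nonempty hΩ hne hc) fun t ht => ?_
  obtain ⟨w, hw, hw0⟩ := (Submodule.ne_bot_iff _).1 ht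
  have h1 := hw.2 w hw.1
  rw [real_inner_self_eq_norm_sq, real_inner_self_eq_norm_sq] at h1
  have h2 := poincare_of_mem_sobolevH10 hs hw.1
  have hpos : 0 < ‖w.fst‖ ^ 2 := by
    rcases (sq_nonneg ‖w.fst‖).lt_or_eq with h | h
    · exact h
    · refine absurd ?_ hw0
      rw [← h, mul_zero] at h1
      have h3 : ‖w‖ ^ 2 = 0 := by rw [WithLp.prod_norm_sq_eq_of_L2, ← h, h1, add_zero]
      exact norm_eq_zero.1 (pow_eq_zero_iff two_ne_zero |>.1 h3)
  rw [h1] at h2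
  exact le_of_mul_le_mul_right h2 hpos

end FirstDirichletEigenvalue

/-! ### Counting Neumann eigenvalues, and the theorem. -/

lemma neumannCount_roomsAndPassages_lt_top (k : ℕ) : neumannCount (roomsAndPassages k) < ⊤ :=
  encard_eigenvalues_lt_top (compactlyEmbedded_roomsAndPassages k) (fun _ _ => Iff.rfl) _

/-- The cut-offs have Rayleigh quotients at most `1 < 7/5`; this gap provides the strict inequality
required by `le_encard_eigenvalues`. -/
lemma le_neumannCount_roomsAndPassages {k : ℕ} (hk : 1 ≤ k) :
    (k : ℕ∞) ≤ neumannCount (roomsAndPassages k) := by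
  have hl : 7 / 5 ≤ firstDirichletEigenvalue (roomsAndPassages k) :=
    le_firstDirichletEigenvalue (isOpen_roomsAndPassages k) (isConnected_roomsAndPassages hk).1
      (fun x hx => Ioo_subset_Icc_self (roomsAndPassages_subset k hx).2)
      (compactlyEmbedded_roomsAndPassages k)
  refine le_encard_eigenvalues (isClosed_sobolevH1 _) (compactlyEmbedded_roomsAndPassages k)
    (fun _ _ => Iff.rfl) (by linarith) (linearIndependent_roomPair k)
    (fun j => roomPair_mem k j) fun u hu hu0 => ?_
  have h1 := norm_snd_sq_le_of_mem_span_roomPair hu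
  have h2 : 0 < ‖u.fst‖ ^ 2 := by
    rcases (sq_nonneg ‖u.fst‖).lt_or_eq with h | h
    · exact h
    · refine absurd ?_ hu0
      have h3 : ‖u‖ ^ 2 ≤ 0 := by rw [WithLp.prod_norm_sq_eq_of_L2]; linarith
      exact norm_eq_zero.1 (pow_eq_zero_iff two_ne_zero |>.1 (le_antisymm h3 (sq_nonneg _)))
  nlinarith

theorem theorem4p6 :
    (∀ k : ℕ, 1 ≤ k → IsBoundedLipschitzDomain (roomsAndPassages k)) ∧
    (∃ C : ℝ≥0, ∀ k : ℕ, 1 ≤ k →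
      isoperimetricRatio (roomsAndPassages k) ≤ C ∧ diameterRatio (roomsAndPassages k) ≤ C) ∧
    (∀ k : ℕ, 1 ≤ k → neumannCount (roomsAndPassages k) < ⊤) ∧
    Tendsto (fun k : ℕ => neumannCount (roomsAndPassages k)) atTop (𝓝 ⊤) ∧
    ¬ ∃ C : ℝ≥0, ∀ Ω : Set Plane, IsBoundedLipschitzDomain Ω →
      (neumannCount Ω : ℝ≥0∞) ≤ C * isoperimetricRatio Ω := by
  refine ⟨fun k hk => isBoundedLipschitzDomain_roomsAndPassages hk,
    ⟨484, fun k hk => ⟨by simpa using isoperimetricRatio_roomsAndPassages_le hk,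
      by simpa using diameterRatio_roomsAndPassages_le hk⟩⟩,
    fun k _ => neumannCount_roomsAndPassages_lt_top k, ?_, ?_⟩
  · refine ENat.tendsto_nhds_top_iff_natCast_lt.2 fun n => ?_
    filter_upwards [eventually_ge_atTop (n + 1)] with k hk
    refine lt_of_lt_of_le ?_ (le_neumannCount_roomsAndPassages (by omega))
    exact_mod_cast (show n < k by omega)
  · rintro ⟨C, hC⟩
    -- On `Ω_{n+1}` the count is at least `n + 1`, but the supposed bound gives at most `484 C < n`.
    obtain ⟨n, hn⟩ := exists_nat_gt (C * 484)
    have h1 := hC _ (isBoundedLipschitzDomain_roomsAndPassages (k := n + 1) (by omega))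
    have h2 : ((n + 1 : ℕ) : ℝ≥0∞) ≤ (neumannCount (roomsAndPassages (n + 1)) : ℝ≥0∞) := by
      have := le_neumannCount_roomsAndPassages (k := n + 1) (by omega)
      exact_mod_cast ENat.toENNReal_le.2 this
    have h3 : ((n + 1 : ℕ) : ℝ≥0∞) ≤ C * 484 :=
      h2.trans (h1.trans (by
        gcongr
        exact isoperimetricRatio_roomsAndPassages_le (by omega)))
    have h4 : ((n + 1 : ℕ) : ℝ≥0) ≤ C * 484 := by exact_mod_cast h3
    have h5 : ((n : ℕ) : ℝ≥0) ≤ ((n + 1 : ℕ) : ℝ≥0) := by exact_mod_cast Nat.le_succ n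
    exact absurd (h5.trans h4) (not_le.2 hn)
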